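/- Let $-\infty\le a<b\le+\infty$ and $S=\{z\in\mathbb C: a<\operatorname{Im} z<b\}$. A substrip of $S$ is a set $S'=\{z\in\mathbb C: a'<\operatorname{Im} z<b'\}$ with real $a',b'$ such that $a<a'<b'<b$. Let $AP(S)$ be the space of analytic almost periodic functions on $S$, i.e. of the functions on $S$ that lie in the closure of the set of finite exponential sums $\sum a_n e^{i\lambda_n z}$, $a_n\in\mathbb C$, $\lambda_n\in\mathbb R$, in the topology of uniform convergence on every substrip of $S$. Let $m\ge 0$ be an integer, let $a_0,\dots,a_m\in AP(S)$ be not all identically zero, and let $w$ be a meromorphic function on $S$ that satisfies $$a_m(z)w^m(z)+a_{m-1}(z)w^{m-1}(z)+\dots+a_1(z)w(z)+a_0(z)=0$$ at every point $z\in S$ that is not a pole of $w$. Suppose that for every substrip $S'$ of $S$ $$\operatorname{card}\{z\in S': |\operatorname{Re} z|<t,\ w(z)=\infty\}=o(t)\quad\text{as } t\to\infty .$$ Then $w$ has no poles in $S$ and $w\in AP(S)$. -/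

import Mathlib

open Filter Asymptotics

/-- The open horizontal strip `{z : a < Im z < b}`; `a = -∞` and `b = +∞` are allowed. -/
def horizontalStrip (a b : EReal) : Set ℂ :=
  {z : ℂ | a < (z.im : EReal) ∧ (z.im : EReal) < b}

/-- `IsSubstrip a' b' a b` says that `{a' < Im z < b'}` is a strip of finite width
with `a < a' < b' < b`, i.e. it is relatively compact in height in `{a < Im z < b}`. -/
def IsSubstrip (a' b' : ℝ) (a b : EReal) : Prop :=
  a < (a' : EReal) ∧ a' < b' ∧ (b' : EReal) < b

/-- Finite exponential sums `∑ aₙ exp (i λₙ z)` with complex `aₙ` and real `λₙ`. -/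
def IsExpSum (p : ℂ → ℂ) : Prop :=
  ∃ (s : Finset ℝ) (c : ℝ → ℂ),
    ∀ z : ℂ, p z = ∑ l ∈ s, c l * Complex.exp (Complex.I * (l : ℂ) * z)

/-- Membership in `AP(S)` for the strip `S = {a < Im z < b}`: `f` lies in the closure of the
finite exponential sums for the topology of uniform convergence on every substrip.
Only the values of `f` on `S` matter. -/
def IsAnalyticAP (a b : EReal) (f : ℂ → ℂ) : Prop :=
  ∀ a' b' : ℝ, IsSubstrip a' b' a b → ∀ ε : ℝ, 0 < ε →
    ∃ p : ℂ → ℂ, IsExpSum p ∧ ∀ z ∈ horizontalStrip (a' : EReal) (b' : EReal), ‖f z - p z‖ < ε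

/-- `z` is a pole of `w`: the meromorphic function `w` has negative order at `z`. -/
def IsPoleAt (w : ℂ → ℂ) (z : ℂ) : Prop :=
  meromorphicOrderAt w z < 0

/-- `w` represents a meromorphic function on `S`: it is meromorphic at every point of `S`, and
at the points of `S` that are not poles it takes its true (finite) value, so that it is
analytic there. The value that `w` takes at a pole (where the function is infinite) is
irrelevant. -/
def IsMeromorphicFunctionOn (w : ℂ → ℂ) (S : Set ℂ) : Prop :=
  MeromorphicOn w S ∧ ∀ z ∈ S, ¬ IsPoleAt w z → AnalyticAt ℂ w z

/-- The number of poles (as points, without multiplicity) of `w` with `a' < Im z < b'` and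
`|Re z| < t`. If `w` is meromorphic on a strip that contains the closure of
`{a' < Im z < b'}`, then the set that is counted is finite. -/
noncomputable def poleCount (w : ℂ → ℂ) (a' b' t : ℝ) : ℕ :=
  Set.ncard {z : ℂ | z ∈ horizontalStrip (a' : EReal) (b' : EReal) ∧ |z.re| < t ∧ IsPoleAt w z}

open Topology Complex

/-! ### Horizontal strips -/

/-! Almost periodicity is used in Bohr's form: `f (z + t)` tends to `f z`, uniformly on substrips,
as `t` tends to `0` in the coarsest topology making all characters of the line continuous
(`bohrFilter`). Limits along ultrafilters replace subsequences. Averaging translates against a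
trigonometric kernel concentrated on the almost periods turns this form back into approximation by
exponential sums (`IsBohrAP.isAnalyticAP`).

The core is `isBohrAP_of_root`: a holomorphic function `W`, bounded on substrips, that satisfies a
nontrivial algebraic equation over the almost periodic functions is itself almost periodic. An
annihilating polynomial `P` of least degree has `P'(W)` not identically zero, and `P'(W)` divides a
nonzero almost periodic function `d`, which bounds it from below. For Bohr-small `t`, the functions
`W (z + s)` and `W (z + s + t)` nearly solve the same equation, so where `d` is not small they
either nearly coincide or stay a fixed distance apart. By the identity theorem, closeness on one
compact set spreads along the whole substrip (`exists_gap_substrip`). Among the shifts by `0, t,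
..., n t` two must be close, because the equation has at most `n` roots (`eventually_exists_close`).
Hence some `j t` with `1 ≤ j ≤ n` is an almost period, and therefore so is `n! t`. Since `t / n!` is
Bohr-small along with `t`, this suffices.

For the theorem, let `g` be the highest coefficient that is not identically zero. Then `W = g w`
satisfies a monic equation, so it is bounded on substrips, extends over the poles and is almost
periodic by the core result. A pole of `W / g` would recur near its translates by a relatively dense
set of almost periods, against the density hypothesis (`not_isPoleAt_of_mul_eq`). So `w` is
holomorphic. It is bounded on substrips by the maximum principle on discs whose boundary circles
avoid the zeros of `g`, and the core result applies to `w` with its original equation. -/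

theorem mem_horizontalStrip_coe {a b : ℝ} {z : ℂ} :
    z ∈ horizontalStrip (a : EReal) (b : EReal) ↔ a < z.im ∧ z.im < b := by
  simp [horizontalStrip]

theorem isOpen_horizontalStrip (a b : EReal) : IsOpen (horizontalStrip a b) := by
  have h : Continuous fun z : ℂ => ((z.im : ℝ) : EReal) :=
    continuous_coe_real_ereal.comp Complex.continuous_im
  exact (isOpen_lt continuous_const h).inter (isOpen_lt h continuous_const)

theorem mem_horizontalStrip_of_im_eq {a b : EReal} {z w : ℂ} (h : w.im = z.im)
    (hz : z ∈ horizontalStrip a b) : w ∈ horizontalStrip a b := by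
  simpa [horizontalStrip, h] using hz

theorem add_ofReal_mem_horizontalStrip {a b : EReal} {z : ℂ} (hz : z ∈ horizontalStrip a b)
    (t : ℝ) : z + t ∈ horizontalStrip a b :=
  mem_horizontalStrip_of_im_eq (by simp) hz

theorem convex_horizontalStrip (a b : EReal) : Convex ℝ (horizontalStrip a b) := by
  have h : horizontalStrip a b = Complex.imLm ⁻¹' {y : ℝ | a < (y : EReal) ∧ (y : EReal) < b} := by
    ext z; simp [horizontalStrip]
  rw [h]
  refine Convex.linear_preimage ?_ _
  refine Set.OrdConnected.convex ⟨fun x hx y hy z hz => ⟨hx.1.trans_le ?_, lt_of_le_of_lt ?_ hy.2⟩⟩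
  · exact_mod_cast hz.1
  · exact_mod_cast hz.2

theorem IsSubstrip.subset {a' b' : ℝ} {a b : EReal} (h : IsSubstrip a' b' a b) :
    horizontalStrip (a' : EReal) (b' : EReal) ⊆ horizontalStrip a b :=
  fun _ hz => ⟨h.1.trans hz.1, hz.2.trans h.2.2⟩

theorem exists_substrip_of_isCompact {a b : EReal} {K : Set ℂ} (hK : IsCompact K)
    (hne : K.Nonempty) (hKS : K ⊆ horizontalStrip a b) :
    ∃ a' b' : ℝ, IsSubstrip a' b' a b ∧ K ⊆ horizontalStrip (a' : EReal) (b' : EReal) := by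
  obtain ⟨x, hxK, hx⟩ := hK.exists_isMinOn hne Complex.continuous_im.continuousOn
  obtain ⟨y, hyK, hy⟩ := hK.exists_isMaxOn hne Complex.continuous_im.continuousOn
  obtain ⟨p, hp, hp'⟩ := EReal.lt_iff_exists_real_btwn.1 (hKS hxK).1
  obtain ⟨q, hq, hq'⟩ := EReal.lt_iff_exists_real_btwn.1 (hKS hyK).2
  have hp' : p < x.im := by exact_mod_cast hp'
  have hq : y.im < q := by exact_mod_cast hq
  have hxy : x.im ≤ y.im := hx hyK
  refine ⟨p, q, ⟨hp, by linarith, hq'⟩, fun z hz => mem_horizontalStrip_coe.2 ⟨?_, ?_⟩⟩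
  · exact hp'.trans_le (hx hz)
  · exact lt_of_le_of_lt (hy hz) hq

theorem exists_substrip_mem {a b : EReal} {z : ℂ} (hz : z ∈ horizontalStrip a b) :
    ∃ a' b' : ℝ, IsSubstrip a' b' a b ∧ z ∈ horizontalStrip (a' : EReal) (b' : EReal) := by
  obtain ⟨a', b', h, hK⟩ := exists_substrip_of_isCompact (isCompact_singleton (x := z))
    (Set.singleton_nonempty z) (by simpa using hz)
  exact ⟨a', b', h, hK rfl⟩

theorem tendstoLocallyUniformlyOn_horizontalStrip {ι : Type*} {p : Filter ι} {F : ι → ℂ → ℂ}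
    {f : ℂ → ℂ} {a b : EReal}
    (h : ∀ a' b' : ℝ, IsSubstrip a' b' a b →
      TendstoUniformlyOn F f p (horizontalStrip (a' : EReal) (b' : EReal))) :
    TendstoLocallyUniformlyOn F f p (horizontalStrip a b) := by
  intro u hu z hz
  obtain ⟨a', b', hs, hz'⟩ := exists_substrip_mem hz
  exact ⟨_, mem_nhdsWithin_of_mem_nhds ((isOpen_horizontalStrip _ _).mem_nhds hz'), h a' b' hs u hu⟩

/-- Two functions holomorphic on a strip that agree near a point agree on the strip. -/
theorem eqOn_horizontalStrip {a b : EReal} {f g : ℂ → ℂ}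
    (hf : DifferentiableOn ℂ f (horizontalStrip a b))
    (hg : DifferentiableOn ℂ g (horizontalStrip a b)) {z : ℂ} (hz : z ∈ horizontalStrip a b)
    (h : f =ᶠ[𝓝 z] g) : Set.EqOn f g (horizontalStrip a b) :=
  (hf.analyticOnNhd (isOpen_horizontalStrip a b)).eqOn_of_preconnected_of_eventuallyEq
    (hg.analyticOnNhd (isOpen_horizontalStrip a b)) (convex_horizontalStrip a b).isPreconnected hz h

/-! ### The Bohr filter -/

/-- The filter of neighbourhoods of `0` for the Bohr topology of the real line. -/
noncomputable def bohrFilter : Filter ℝ :=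
  comap (fun (t : ℝ) (l : ℝ) => cexp (I * l * t)) (𝓝 1)

theorem tendsto_bohrFilter_iff {ι : Type*} {p : Filter ι} {x : ι → ℝ} :
    Tendsto x p bohrFilter ↔ ∀ l : ℝ, Tendsto (fun i => cexp (I * l * x i)) p (𝓝 1) := by
  rw [bohrFilter, tendsto_comap_iff, tendsto_pi_nhds]; rfl

theorem tendsto_exp_bohrFilter (l : ℝ) :
    Tendsto (fun t : ℝ => cexp (I * l * t)) bohrFilter (𝓝 1) :=
  tendsto_bohrFilter_iff.1 tendsto_id l

instance : bohrFilter.NeBot := by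
  have h : Tendsto (fun _ : Unit => (0 : ℝ)) ⊤ bohrFilter := by
    simp [tendsto_bohrFilter_iff]
  exact h.neBot

theorem tendsto_nat_mul_bohrFilter (n : ℕ) :
    Tendsto (fun t : ℝ => n * t) bohrFilter bohrFilter := by
  refine tendsto_bohrFilter_iff.2 fun l => ?_
  have := (tendsto_exp_bohrFilter l).pow n
  rw [one_pow] at this
  refine this.congr fun t => ?_
  rw [← Complex.exp_nat_mul]; push_cast; ring_nf

theorem tendsto_div_bohrFilter (r : ℝ) : Tendsto (fun t : ℝ => t / r) bohrFilter bohrFilter := by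
  refine tendsto_bohrFilter_iff.2 fun l => (tendsto_exp_bohrFilter (l / r)).congr fun t => ?_
  push_cast; ring_nf

theorem norm_exp_I_mul_ofReal_mul (l t : ℝ) : ‖cexp (I * l * t)‖ = 1 := by
  rw [show I * l * t = ((l * t : ℝ) : ℂ) * I by push_cast; ring, Complex.norm_exp_ofReal_mul_I]

/-- A bounded function has a limit along every ultrafilter. -/
theorem exists_tendsto_of_norm_le {ι : Type*} (U : Ultrafilter ι) {g : ι → ℂ} {C : ℝ}
    (h : ∀ᶠ i in (U : Filter ι), ‖g i‖ ≤ C) : ∃ c, ‖c‖ ≤ C ∧ Tendsto g U (𝓝 c) := by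
  obtain ⟨c, hc, hle⟩ := (isCompact_closedBall (0 : ℂ) C).ultrafilter_le_nhds (U.map g)
    (by
      rw [le_principal_iff]
      have : ∀ᶠ w in (U.map g : Filter ℂ), ‖w‖ ≤ C := by simpa using h
      filter_upwards [this] with w hw
      simpa using hw)
  exact ⟨c, by simpa using hc, hle⟩

/-- Real sequences are Cauchy along ultrafilters for the Bohr topology. -/
theorem tendsto_sub_bohrFilter {ι : Type*} (U : Ultrafilter ι) (x : ι → ℝ) :
    Tendsto (fun q : ι × ι => x q.1 - x q.2) ((U : Filter ι) ×ˢ (U : Filter ι)) bohrFilter := by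
  refine tendsto_bohrFilter_iff.2 fun l => ?_
  have hn : ∀ t : ℝ, ‖cexp (I * l * t)‖ = 1 := norm_exp_I_mul_ofReal_mul l
  obtain ⟨c, -, hc⟩ := exists_tendsto_of_norm_le U (g := fun i => cexp (I * l * x i)) (C := 1)
    (Eventually.of_forall fun i => (hn _).le)
  have hc1 : ‖c‖ = 1 := by
    refine tendsto_nhds_unique hc.norm ?_
    simp only [hn]; exact tendsto_const_nhds
  have hc0 : c ≠ 0 := by rintro rfl; simp at hc1
  have h := (hc.comp tendsto_fst).div (hc.comp (tendsto_snd (f := (U : Filter ι)))) hc0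
  rw [div_self hc0] at h
  refine h.congr fun q => ?_
  simp only [Function.comp, Pi.div_apply]
  rw [← Complex.exp_sub]; push_cast; ring_nf

/-- Neighbourhoods of `0` in the Bohr topology are relatively dense: finitely many translates
cover the line. -/
theorem exists_finset_translates {V : Set ℝ} (hV : V ∈ bohrFilter) :
    ∃ F : Finset ℝ, ∀ t, ∃ s ∈ F, t - s ∈ V := by
  by_contra! hcon
  -- Greedy choice: without a finite cover there is a sequence all of whose forward differences
  -- avoid `V`, although it is Cauchy along a nonprincipal ultrafilter.
  obtain ⟨x, -, hx⟩ := exists_seq_of_forall_finset_exists (fun _ : ℝ => True)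
    (fun s t => t - s ∉ V) (fun F _ => by
      obtain ⟨t, ht⟩ := hcon F
      exact ⟨t, trivial, ht⟩)
  let U := hyperfilter ℕ
  have h := ((tendsto_sub_bohrFilter U x).comp tendsto_prod_swap).eventually hV
  obtain ⟨j, hj⟩ := h.curry.exists
  have hgt : ∀ᶠ i in (U : Filter ℕ), j < i :=
    (Nat.cofinite_eq_atTop ▸ hyperfilter_le_cofinite) (eventually_gt_atTop j)
  obtain ⟨i, hi, hji⟩ := (hj.and hgt).exists
  exact hx j i hji hi

/-! ### Almost periodic functions in the sense of Bohr -/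

/-- `f` is bounded on every substrip of `{a < Im z < b}`. -/
def BddOnSubstrips (a b : EReal) (f : ℂ → ℂ) : Prop :=
  ∀ a' b' : ℝ, IsSubstrip a' b' a b →
    ∃ C, ∀ z ∈ horizontalStrip (a' : EReal) (b' : EReal), ‖f z‖ ≤ C

/-- `f` is holomorphic on `{a < Im z < b}`, bounded on substrips, and on each substrip its
almost periods form neighbourhoods of `0` for the Bohr topology. -/
structure IsBohrAP (a b : EReal) (f : ℂ → ℂ) : Prop where
  differentiableOn : DifferentiableOn ℂ f (horizontalStrip a b)
  bdd : BddOnSubstrips a b f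
  unif : ∀ a' b' : ℝ, IsSubstrip a' b' a b →
    TendstoUniformlyOn (fun (t : ℝ) z => f (z + t)) f bohrFilter
      (horizontalStrip (a' : EReal) (b' : EReal))

namespace BddOnSubstrips

variable {a b : EReal} {f g : ℂ → ℂ}

theorem exists_pos (h : BddOnSubstrips a b f) {a' b' : ℝ} (hs : IsSubstrip a' b' a b) :
    ∃ C, 0 < C ∧ ∀ z ∈ horizontalStrip (a' : EReal) (b' : EReal), ‖f z‖ ≤ C := by
  obtain ⟨C, hC⟩ := h a' b' hs
  exact ⟨max C 1, by positivity, fun z hz => (hC z hz).trans (le_max_left _ _)⟩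

theorem add (hf : BddOnSubstrips a b f) (hg : BddOnSubstrips a b g) :
    BddOnSubstrips a b (fun z => f z + g z) := fun a' b' h => by
  obtain ⟨C, hC⟩ := hf a' b' h
  obtain ⟨D, hD⟩ := hg a' b' h
  exact ⟨C + D, fun z hz => norm_add_le_of_le (hC z hz) (hD z hz)⟩

theorem mul (hf : BddOnSubstrips a b f) (hg : BddOnSubstrips a b g) :
    BddOnSubstrips a b (fun z => f z * g z) := fun a' b' h => by
  obtain ⟨C, hC⟩ := hf a' b' h
  obtain ⟨D, hD⟩ := hg a' b' h
  exact ⟨C * D, fun z hz => norm_mul_le_of_le (hC z hz) (hD z hz)⟩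

theorem const (c : ℂ) : BddOnSubstrips a b (fun _ => c) :=
  fun _ _ _ => ⟨‖c‖, fun _ _ => le_rfl⟩

end BddOnSubstrips

namespace IsBohrAP

variable {a b : EReal} {f g : ℂ → ℂ}

theorem const (c : ℂ) : IsBohrAP a b (fun _ => c) where
  differentiableOn := differentiableOn_const c
  bdd := .const c
  unif := fun _ _ _ _ hu => Eventually.of_forall fun _ _ _ => refl_mem_uniformity hu

theorem add (hf : IsBohrAP a b f) (hg : IsBohrAP a b g) : IsBohrAP a b (fun z => f z + g z) where
  differentiableOn := hf.differentiableOn.add hg.differentiableOn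
  bdd := hf.bdd.add hg.bdd
  unif := fun a' b' h => (hf.unif a' b' h).add (hg.unif a' b' h)

theorem mul (hf : IsBohrAP a b f) (hg : IsBohrAP a b g) : IsBohrAP a b (fun z => f z * g z) where
  differentiableOn := hf.differentiableOn.mul hg.differentiableOn
  bdd := hf.bdd.mul hg.bdd
  unif := fun a' b' h => by
    obtain ⟨C, hC0, hC⟩ := hf.bdd.exists_pos h
    obtain ⟨D, hD0, hD⟩ := hg.bdd.exists_pos h
    rw [Metric.tendstoUniformlyOn_iff]
    intro ε hε
    filter_upwards [Metric.tendstoUniformlyOn_iff.1 (hf.unif a' b' h) (ε / (2 * D)) (by positivity),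
      Metric.tendstoUniformlyOn_iff.1 (hg.unif a' b' h) (ε / (2 * C)) (by positivity)]
      with t hft hgt z hz
    have h1 := hft z hz
    have h2 := hgt z hz
    rw [dist_eq_norm] at h1 h2 ⊢
    have hz' := add_ofReal_mem_horizontalStrip hz t
    calc ‖f z * g z - f (z + t) * g (z + t)‖
        = ‖(f z - f (z + t)) * g (z + t) + f z * (g z - g (z + t))‖ := by ring_nf
      _ ≤ ‖f z - f (z + t)‖ * ‖g (z + t)‖ + ‖f z‖ * ‖g z - g (z + t)‖ := by
        refine (norm_add_le _ _).trans (by rw [norm_mul, norm_mul])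
      _ ≤ ‖f z - f (z + t)‖ * D + C * ‖g z - g (z + t)‖ := by
        gcongr
        exacts [hD _ hz', hC _ hz]
      _ < ε / (2 * D) * D + C * (ε / (2 * C)) := by gcongr
      _ = ε := by field_simp; norm_num

theorem neg (hf : IsBohrAP a b f) : IsBohrAP a b (fun z => -f z) := by
  simpa using (const (-1)).mul hf

theorem sum {ι : Type*} {s : Finset ι} {F : ι → ℂ → ℂ} (h : ∀ i ∈ s, IsBohrAP a b (F i)) :
    IsBohrAP a b (fun z => ∑ i ∈ s, F i z) := by
  classical
  induction s using Finset.induction_on with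
  | empty => simpa using const 0
  | insert i s hi ih =>
    simp only [Finset.sum_insert hi]
    exact (h i (by simp)).add (ih fun j hj => h j (by simp [hj]))

theorem pow (hf : IsBohrAP a b f) (n : ℕ) : IsBohrAP a b (fun z => f z ^ n) := by
  induction n with
  | zero => simpa using const 1
  | succ n ih => simpa only [pow_succ] using ih.mul hf

theorem congr (hf : IsBohrAP a b f) (h : Set.EqOn f g (horizontalStrip a b)) :
    IsBohrAP a b g where
  differentiableOn := hf.differentiableOn.congr fun z hz => (h hz).symm
  bdd := fun a' b' hs => by
    obtain ⟨C, hC⟩ := hf.bdd a' b' hs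
    exact ⟨C, fun z hz => h (hs.subset hz) ▸ hC z hz⟩
  unif := fun a' b' hs => ((hf.unif a' b' hs).congr_right fun z hz => h (hs.subset hz)).congr <|
    Eventually.of_forall fun t z hz => h (hs.subset (add_ofReal_mem_horizontalStrip hz t))

theorem exp (l : ℝ) : IsBohrAP a b (fun z => cexp (I * l * z)) := by
  have hbdd : BddOnSubstrips a b (fun z => cexp (I * l * z)) := fun a' b' h => by
    refine ⟨Real.exp (|l| * max |a'| |b'|), fun z hz => ?_⟩
    rw [Complex.norm_exp]
    refine Real.exp_le_exp.2 ?_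
    have hz := mem_horizontalStrip_coe.1 hz
    have : (I * l * z).re = -l * z.im := by simp
    rw [this]
    calc -l * z.im ≤ |-l * z.im| := le_abs_self _
      _ = |l| * |z.im| := by rw [abs_mul, abs_neg]
      _ ≤ _ := by
        gcongr
        exact abs_le_max_abs_abs hz.1.le hz.2.le
  refine ⟨Differentiable.differentiableOn (by fun_prop), hbdd, fun a' b' h => ?_⟩
  obtain ⟨C, hC0, hC⟩ := hbdd.exists_pos h
  rw [Metric.tendstoUniformlyOn_iff]
  intro ε hε
  filter_upwards [Metric.tendsto_nhds.1 (tendsto_exp_bohrFilter l) (ε / C) (by positivity)]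
    with t ht z hz
  rw [dist_eq_norm] at ht
  rw [dist_comm, dist_eq_norm]
  calc ‖cexp (I * l * (z + t)) - cexp (I * l * z)‖
      = ‖cexp (I * l * z)‖ * ‖cexp (I * l * t) - 1‖ := by
        rw [← norm_mul, mul_sub, mul_one, ← Complex.exp_add, mul_add]
    _ ≤ C * ‖cexp (I * l * t) - 1‖ := by gcongr; exact hC z hz
    _ < C * (ε / C) := by gcongr
    _ = ε := by field_simp

end IsBohrAP

theorem IsExpSum.isBohrAP {p : ℂ → ℂ} (hp : IsExpSum p) (a b : EReal) : IsBohrAP a b p := by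
  obtain ⟨s, c, hp⟩ := hp
  obtain rfl : p = fun z => ∑ l ∈ s, c l * cexp (I * (l : ℂ) * z) := funext hp
  exact IsBohrAP.sum fun l _ => (IsBohrAP.const (c l)).mul (IsBohrAP.exp l)

theorem IsAnalyticAP.isBohrAP {a b : EReal} {f : ℂ → ℂ} (hf : IsAnalyticAP a b f) :
    IsBohrAP a b f where
  differentiableOn := by
    intro z hz
    obtain ⟨a', b', hs, hz'⟩ := exists_substrip_mem hz
    choose p hp hfp using fun n : ℕ => hf a' b' hs (1 / ((n : ℝ) + 1)) (by positivity)
    have hu : TendstoUniformlyOn p f atTop (horizontalStrip (a' : EReal) (b' : EReal)) := by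
      rw [Metric.tendstoUniformlyOn_iff]
      intro ε hε
      filter_upwards [(tendsto_order.1 tendsto_one_div_add_atTop_nhds_zero_nat).2 ε hε] with n hn w hw
      rw [dist_eq_norm]
      exact (hfp n w hw).trans hn
    have hd := hu.tendstoLocallyUniformlyOn.differentiableOn
      (Eventually.of_forall fun n => ((hp n).isBohrAP _ _).differentiableOn)
      (isOpen_horizontalStrip _ _)
    exact (hd.differentiableAt ((isOpen_horizontalStrip _ _).mem_nhds hz')).differentiableWithinAt
  bdd := fun a' b' hs => by
    obtain ⟨p, hp, hfp⟩ := hf a' b' hs 1 one_pos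
    obtain ⟨C, hC⟩ := (hp.isBohrAP a b).bdd a' b' hs
    refine ⟨1 + C, fun z hz => ?_⟩
    calc ‖f z‖ = ‖(f z - p z) + p z‖ := by ring_nf
      _ ≤ _ := norm_add_le_of_le (hfp z hz).le (hC z hz)
  unif := fun a' b' hs => by
    rw [Metric.tendstoUniformlyOn_iff]
    intro ε hε
    obtain ⟨p, hp, hfp⟩ := hf a' b' hs (ε / 3) (by positivity)
    filter_upwards [Metric.tendstoUniformlyOn_iff.1 ((hp.isBohrAP a b).unif a' b' hs) (ε / 3)
      (by positivity)] with t ht z hz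
    have h1 := hfp z hz
    have h2 := hfp _ (add_ofReal_mem_horizontalStrip hz t)
    have h3 := ht z hz
    rw [← dist_eq_norm] at h1 h2
    have := dist_triangle4 (f z) (p z) (p (z + t)) (f (z + t))
    rw [dist_comm (p (z + t))] at this
    linarith

/-! ### Exponential sums form an algebra -/

theorem isExpSum_iff_mem_span {p : ℂ → ℂ} :
    IsExpSum p ↔ p ∈ Submodule.span ℂ (Set.range fun (l : ℝ) (z : ℂ) => cexp (I * l * z)) := by
  rw [Finsupp.mem_span_range_iff_exists_finsupp]
  constructor
  · rintro ⟨s, c, h⟩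
    classical
    refine ⟨Finsupp.onFinset s (fun l => if l ∈ s then c l else 0) (by simp +contextual), ?_⟩
    rw [Finsupp.onFinset_sum _ (by simp)]
    ext z
    rw [h z, Finset.sum_apply]
    exact Finset.sum_congr rfl fun l hl => by simp [hl]
  · rintro ⟨c, rfl⟩
    exact ⟨c.support, c, fun z => by simp [Finsupp.sum]⟩

namespace IsExpSum

variable {p q : ℂ → ℂ}

theorem add (hp : IsExpSum p) (hq : IsExpSum q) : IsExpSum (p + q) := by
  rw [isExpSum_iff_mem_span] at *
  exact add_mem hp hq

theorem smul (c : ℂ) (hp : IsExpSum p) : IsExpSum (c • p) := by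
  rw [isExpSum_iff_mem_span] at *
  exact Submodule.smul_mem _ c hp

theorem exp (l : ℝ) : IsExpSum (fun z => cexp (I * l * z)) :=
  isExpSum_iff_mem_span.2 (Submodule.subset_span ⟨l, rfl⟩)

theorem one : IsExpSum 1 := by
  simpa [Pi.one_def] using exp 0

theorem sum {ι : Type*} {s : Finset ι} {F : ι → ℂ → ℂ} (h : ∀ i ∈ s, IsExpSum (F i)) :
    IsExpSum (∑ i ∈ s, F i) := by
  simp only [isExpSum_iff_mem_span] at *
  exact sum_mem h

theorem mul (hp : IsExpSum p) (hq : IsExpSum q) : IsExpSum (p * q) := by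
  obtain ⟨s, c, hp⟩ := hp
  obtain ⟨s', c', hq⟩ := hq
  have : p * q = ∑ l ∈ s, ∑ l' ∈ s', (c l * c' l') • fun z : ℂ => cexp (I * ((l + l' : ℝ) : ℂ) * z) := by
    ext z
    simp only [Pi.mul_apply, hp, hq, Finset.sum_mul_sum, Finset.sum_apply, Pi.smul_apply,
      smul_eq_mul]
    refine Finset.sum_congr rfl fun l _ => Finset.sum_congr rfl fun l' _ => ?_
    rw [ofReal_add, mul_add, add_mul, Complex.exp_add]; ring
  rw [this]
  exact sum fun l _ => sum fun l' _ => (exp _).smul _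

theorem pow (hp : IsExpSum p) (n : ℕ) : IsExpSum (p ^ n) := by
  induction n with
  | zero => simpa using one
  | succ n ih => simpa only [pow_succ] using ih.mul hp

end IsExpSum

/-! ### Mean values -/

/-- The mean value of `h` over the horizontal segment of length `2 T` centred at `z`. -/
noncomputable def segmentMean (h : ℂ → ℂ) (z : ℂ) (T : ℝ) : ℂ :=
  (2 * T : ℂ)⁻¹ * ∫ t in (-T)..T, h (z + t)

theorem continuous_comp_add_ofReal {a b : EReal} {h : ℂ → ℂ}
    (hd : ContinuousOn h (horizontalStrip a b)) {z : ℂ} (hz : z ∈ horizontalStrip a b) :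
    Continuous fun t : ℝ => h (z + t) :=
  hd.comp_continuous (by fun_prop) fun t => add_ofReal_mem_horizontalStrip hz t

/-- The two windows of integration differ only in end pieces of length `|w.re - z.re|`; the bound is
independent of `T`. -/
theorem norm_integral_sub_le_of_im_eq {a b : EReal} {h : ℂ → ℂ}
    (hd : ContinuousOn h (horizontalStrip a b)) {z w : ℂ} (hz : z ∈ horizontalStrip a b)
    (him : w.im = z.im) {C : ℝ} (hC : ∀ u : ℂ, u.im = z.im → ‖h u‖ ≤ C) (T : ℝ) :
    ‖(∫ t in (-T)..T, h (z + t)) - ∫ t in (-T)..T, h (w + t)‖ ≤ 2 * C * |w.re - z.re| := by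
  set x : ℝ := w.re - z.re with hx
  have hw : w = z + x := by apply Complex.ext <;> simp [hx, him]
  have hcont := continuous_comp_add_ofReal hd hz
  have e : (∫ t in (-T)..T, h (w + t)) = ∫ t in (x + -T)..(x + T), h (z + t) := by
    rw [← intervalIntegral.integral_comp_add_left (fun t : ℝ => h (z + t))]
    refine intervalIntegral.integral_congr fun t _ => ?_
    simp only [hw]; push_cast; ring_nf
  have hi : ∀ p q : ℝ, IntervalIntegrable (fun t : ℝ => h (z + t)) MeasureTheory.volume p q :=
    fun p q => hcont.intervalIntegrable p q
  rw [e, intervalIntegral.integral_interval_sub_interval_comm (hi _ _) (hi _ _) (hi _ _)]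
  have hb : ∀ p q : ℝ, ‖∫ t in p..q, h (z + t)‖ ≤ C * |q - p| := fun p q =>
    intervalIntegral.norm_integral_le_of_norm_le_const fun t _ => hC _ (by simp)
  refine (norm_sub_le _ _).trans ((add_le_add (hb _ _) (hb _ _)).trans (le_of_eq ?_))
  rw [show x + -T - -T = x by ring, show x + T - T = x by ring]; ring

/-- By Cauchy's theorem on a rectangle the difference is carried by the two vertical sides, whose
length does not depend on `T`. -/
theorem norm_integral_sub_le_of_re_eq {a b : EReal} {h : ℂ → ℂ}
    (hd : DifferentiableOn ℂ h (horizontalStrip a b)) {z w : ℂ} (hz : z ∈ horizontalStrip a b)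
    (hw : w ∈ horizontalStrip a b) (hre : w.re = z.re) {C : ℝ}
    (hC : ∀ u : ℂ, u.im ∈ Set.uIcc z.im w.im → ‖h u‖ ≤ C) (T : ℝ) :
    ‖(∫ t in (-T)..T, h (z + t)) - ∫ t in (-T)..T, h (w + t)‖ ≤ 2 * C * |w.im - z.im| := by
  have key := Complex.integral_boundary_rect_eq_zero_of_differentiableOn h
    ((z.re - T : ℝ) + z.im * I) ((z.re + T : ℝ) + w.im * I) (hd.mono fun u hu => by
      have hu : u.im ∈ Set.uIcc z.im w.im := by simpa using hu.2
      have hS := (convex_horizontalStrip a b)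
      have h1 : (Complex.mk 0 z.im) ∈ horizontalStrip a b := mem_horizontalStrip_of_im_eq rfl hz
      have h2 : (Complex.mk 0 w.im) ∈ horizontalStrip a b := mem_horizontalStrip_of_im_eq rfl hw
      rcases Set.mem_uIcc.1 hu with hu | hu
      · exact ⟨hz.1.trans_le (by exact_mod_cast hu.1), lt_of_le_of_lt (by exact_mod_cast hu.2) hw.2⟩
      · exact ⟨hw.1.trans_le (by exact_mod_cast hu.1), lt_of_le_of_lt (by exact_mod_cast hu.2) hz.2⟩)
  simp only [add_re, add_im, ofReal_re, ofReal_im, mul_re, mul_im, I_re, I_im, mul_zero, mul_one,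
    sub_zero, zero_add, add_zero] at key
  have e1 : ∀ v : ℂ, v.re = z.re → (∫ t in (-T)..T, h (v + t))
      = ∫ x in (z.re - T)..(z.re + T), h (x + v.im * I) := by
    intro v hv
    rw [show z.re - T = z.re + -T by ring,
      ← intervalIntegral.integral_comp_add_left (fun t : ℝ => h (t + v.im * I))]
    refine intervalIntegral.integral_congr fun t _ => ?_
    show h (v + t) = h ((z.re + t : ℝ) + v.im * I)
    congr 1
    rw [← hv]
    apply Complex.ext <;> simp
  rw [e1 z rfl, e1 w hre]
  have hb : ∀ x : ℝ, ‖I • ∫ y in z.im..w.im, h (x + y * I)‖ ≤ C * |w.im - z.im| := fun x => by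
    rw [norm_smul, Complex.norm_I, one_mul]
    refine intervalIntegral.norm_integral_le_of_norm_le_const fun y hy => hC _ ?_
    simpa using Set.uIoc_subset_uIcc hy
  have : (∫ x in (z.re - T)..(z.re + T), h (x + z.im * I))
      - ∫ x in (z.re - T)..(z.re + T), h (x + w.im * I)
      = (I • ∫ y in z.im..w.im, h ((z.re - T : ℝ) + y * I))
        - I • ∫ y in z.im..w.im, h ((z.re + T : ℝ) + y * I) := by
    linear_combination key
  rw [this]
  refine (norm_sub_le _ _).trans ((add_le_add (hb _) (hb _)).trans (le_of_eq (by ring)))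

/-- The mean value of a function that is holomorphic in a strip and bounded on substrips is
asymptotically independent of the point. -/
theorem tendsto_segmentMean_sub {a b : EReal} {h : ℂ → ℂ}
    (hd : DifferentiableOn ℂ h (horizontalStrip a b)) (hb : BddOnSubstrips a b h) {z w : ℂ}
    (hz : z ∈ horizontalStrip a b) (hw : w ∈ horizontalStrip a b) :
    Tendsto (fun T => segmentMean h z T - segmentMean h w T) atTop (𝓝 0) := by
  set v : ℂ := ⟨z.re, w.im⟩ with hv
  have hvS : v ∈ horizontalStrip a b := mem_horizontalStrip_of_im_eq rfl hw
  obtain ⟨a', b', hs, hsub⟩ := exists_substrip_of_isCompact (a := a) (b := b) (K := {z, w})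
    (Set.toFinite _).isCompact (Set.insert_nonempty _ _) (by
      rintro u (rfl | rfl) <;> assumption)
  obtain ⟨C, hC0, hC⟩ := hb.exists_pos hs
  have hz' := mem_horizontalStrip_coe.1 (hsub (Set.mem_insert z {w}))
  have hw' := mem_horizontalStrip_coe.1 (hsub (Set.mem_insert_of_mem z (Set.mem_singleton w)))
  set B := 2 * C * |w.im - z.im| + 2 * C * |w.re - z.re| with hB
  have hle : ∀ T : ℝ, ‖(∫ t in (-T)..T, h (z + t)) - ∫ t in (-T)..T, h (w + t)‖ ≤ B := fun T => by
    have h1 := norm_integral_sub_le_of_re_eq hd hz hvS rfl (C := C) (fun u hu => hC u (by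
      rw [mem_horizontalStrip_coe]
      have hu : u.im ∈ Set.uIcc z.im w.im := hu
      rcases Set.mem_uIcc.1 hu with hu | hu
      · exact ⟨hz'.1.trans_le hu.1, hu.2.trans_lt hw'.2⟩
      · exact ⟨hw'.1.trans_le hu.1, hu.2.trans_lt hz'.2⟩)) T
    have h2 := norm_integral_sub_le_of_im_eq hd.continuousOn hvS (w := w) rfl (C := C)
      (fun u hu => hC u (mem_horizontalStrip_coe.2 (by
        have hu : u.im = w.im := hu
        rwa [hu]))) T
    have := norm_sub_le_norm_sub_add_norm_sub (∫ t in (-T)..T, h (z + t))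
      (∫ t in (-T)..T, h (v + t)) (∫ t in (-T)..T, h (w + t))
    exact this.trans (add_le_add h1 h2)
  have hlim : Tendsto (fun T : ℝ => (2 * T)⁻¹ * B) atTop (𝓝 0) := by
    have : Tendsto (fun T : ℝ => (2 * T)⁻¹) atTop (𝓝 0) :=
      tendsto_inv_atTop_zero.comp (tendsto_id.const_mul_atTop two_pos)
    simpa using this.mul_const B
  refine squeeze_zero_norm' ?_ hlim
  filter_upwards [eventually_gt_atTop 0] with T hT
  rw [segmentMean, segmentMean, ← mul_sub, norm_mul]
  have : ‖(2 * T : ℂ)⁻¹‖ = (2 * T)⁻¹ := by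
    rw [norm_inv, norm_mul, Complex.norm_real, Real.norm_of_nonneg hT.le]; simp
  rw [this]
  gcongr
  exact hle T

theorem norm_segmentMean_le {h : ℂ → ℂ} {z : ℂ} {C : ℝ} (hC : ∀ t : ℝ, ‖h (z + t)‖ ≤ C) {T : ℝ}
    (hT : 0 < T) : ‖segmentMean h z T‖ ≤ C := by
  have h1 : ‖∫ t in (-T)..T, h (z + t)‖ ≤ C * |T - -T| :=
    intervalIntegral.norm_integral_le_of_norm_le_const fun t _ => hC t
  have h2 : ‖(2 * T : ℂ)⁻¹‖ = (2 * T)⁻¹ := by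
    rw [norm_inv, norm_mul, Complex.norm_real, Real.norm_of_nonneg hT.le]; simp
  rw [segmentMean, norm_mul, h2]
  rw [show T - -T = 2 * T by ring, abs_of_pos (by positivity)] at h1
  calc (2 * T)⁻¹ * ‖∫ t in (-T)..T, h (z + t)‖ ≤ (2 * T)⁻¹ * (C * (2 * T)) := by gcongr
    _ = C := by field_simp

/-- Along an ultrafilter, the mean values converge to a limit independent of the point. -/
theorem exists_tendsto_segmentMean {a b : EReal} {h : ℂ → ℂ}
    (hd : DifferentiableOn ℂ h (horizontalStrip a b)) (hb : BddOnSubstrips a b h)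
    (U : Ultrafilter ℝ) (hU : (U : Filter ℝ) ≤ atTop) :
    ∃ c, ∀ z ∈ horizontalStrip a b, Tendsto (segmentMean h z) U (𝓝 c) := by
  rcases (horizontalStrip a b).eq_empty_or_nonempty with he | ⟨w, hw⟩
  · exact ⟨0, by simp [he]⟩
  obtain ⟨a', b', hs, hw'⟩ := exists_substrip_mem hw
  obtain ⟨C, hC⟩ := hb a' b' hs
  obtain ⟨c, -, hc⟩ := exists_tendsto_of_norm_le U (g := segmentMean h w) (C := C) (by
    filter_upwards [hU (eventually_gt_atTop 0)] with T hT
    exact norm_segmentMean_le (fun t => hC _ (add_ofReal_mem_horizontalStrip hw' t)) hT)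
  refine ⟨c, fun z hz => ?_⟩
  simpa using ((tendsto_segmentMean_sub hd hb hz hw).mono_left hU).add hc

/-- Averaging the translates of a function against an exponential sum gives an exponential sum. -/
theorem IsExpSum.exists_tendsto_mean_mul {a b : EReal} {f K : ℂ → ℂ}
    (hd : DifferentiableOn ℂ f (horizontalStrip a b)) (hb : BddOnSubstrips a b f)
    (hK : IsExpSum K) (U : Ultrafilter ℝ) (hU : (U : Filter ℝ) ≤ atTop) :
    ∃ p, IsExpSum p ∧ ∀ z ∈ horizontalStrip a b,
      Tendsto (fun T : ℝ => (2 * T : ℂ)⁻¹ * ∫ t in (-T)..T, f (z + t) * K t) U (𝓝 (p z)) := by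
  obtain ⟨s, k, hK⟩ := hK
  have hm : ∀ l : ℝ, ∃ c, ∀ z ∈ horizontalStrip a b,
      Tendsto (segmentMean (fun u => f u * cexp (I * l * u)) z) U (𝓝 c) := fun l =>
    exists_tendsto_segmentMean (hd.mul (IsBohrAP.exp l).differentiableOn)
      (hb.mul (IsBohrAP.exp l).bdd) U hU
  choose c hc using hm
  -- The product `f (z + t) exp (i l t)` is `exp (-i l z)` times the value of `f exp (i l ·)` at `z
  -- + t`, and the mean of the latter is the constant `c l`, a Fourier coefficient.
  refine ⟨∑ l ∈ s, (k l * c l) • fun z : ℂ => cexp (I * ((-l : ℝ) : ℂ) * z),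
    IsExpSum.sum fun l _ => (IsExpSum.exp _).smul _, fun z hz => ?_⟩
  have hlim := tendsto_finsetSum s fun l _ =>
    (hc l z hz).const_mul (k l * cexp (I * ((-l : ℝ) : ℂ) * z))
  have hval : (∑ l ∈ s, (k l * c l) • fun z : ℂ => cexp (I * ((-l : ℝ) : ℂ) * z)) z
      = ∑ l ∈ s, k l * cexp (I * ((-l : ℝ) : ℂ) * z) * c l := by
    simp only [Finset.sum_apply, Pi.smul_apply, smul_eq_mul]
    exact Finset.sum_congr rfl fun l _ => by ring
  rw [hval]
  refine hlim.congr fun T => ?_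
  have hf := continuous_comp_add_ofReal hd.continuousOn hz
  simp only [segmentMean]
  have e : ∀ t : ℝ, f (z + t) * K t = ∑ l ∈ s, (k l * cexp (I * ((-l : ℝ) : ℂ) * z)) *
      (f (z + t) * cexp (I * l * (z + t))) := fun t => by
    rw [hK, Finset.mul_sum]
    refine Finset.sum_congr rfl fun l _ => ?_
    have : cexp (I * l * t) = cexp (I * ((-l : ℝ) : ℂ) * z) * cexp (I * l * (z + t)) := by
      rw [← Complex.exp_add]; push_cast; ring_nf
    rw [this]; ring
  simp only [e]
  rw [intervalIntegral.integral_finsetSum, Finset.mul_sum]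
  · refine Finset.sum_congr rfl fun l _ => ?_
    rw [intervalIntegral.integral_const_mul]; ring
  · intro l _
    exact (continuous_const.mul (hf.mul (by fun_prop))).intervalIntegrable _ _

/-! ### A summation kernel -/

/-- For every neighbourhood `V` of `0` in the Bohr topology there is an exponential sum with
values in `[0, 1]` on the real line that tends to `1` at `0` and stays away from `1` off `V`. -/
theorem exists_kernel {V : Set ℝ} (hV : V ∈ bohrFilter) :
    ∃ (q : ℝ → ℝ) (Q : ℂ → ℂ) (α : ℝ), IsExpSum Q ∧ (∀ t : ℝ, Q t = q t) ∧ Continuous q ∧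
      (∀ t, 0 ≤ q t ∧ q t ≤ 1) ∧ Tendsto q bohrFilter (𝓝 1) ∧ 0 ≤ α ∧ α < 1 ∧
      ∀ t ∉ V, q t ≤ α := by
  obtain ⟨W, hW, hWV⟩ := hV
  rw [nhds_pi] at hW
  obtain ⟨⟨s, r⟩, ⟨hs, hr⟩, hsub⟩ := (Filter.hasBasis_pi fun l : ℝ =>
    Metric.nhds_basis_ball (x := (1 : ℝ → ℂ) l)).mem_iff.1 hW
  obtain ⟨δ, hδ0, hδ⟩ : ∃ δ : ℝ, 0 < δ ∧ ∀ l ∈ s, δ ≤ r l := by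
    rcases hs.toFinset.eq_empty_or_nonempty with he | hne
    · exact ⟨1, one_pos, fun l hl => by simp_all⟩
    · obtain ⟨l, hl, hmin⟩ := hs.toFinset.exists_min_image r hne
      exact ⟨r l, hr l (by simpa using hl), fun j hj => hmin j (by simpa using hj)⟩
  -- The `+ 1` keeps `n` positive when no frequency is involved. Each `d l t` is at most `4`, whence
  -- the factor `(4 * n)⁻¹`.
  set n : ℝ := hs.toFinset.card + 1 with hn
  have hn0 : 0 < n := by positivity
  let d : ℝ → ℝ → ℝ := fun l t => ‖cexp (I * l * t) - 1‖ ^ 2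
  let q : ℝ → ℝ := fun t => 1 - (4 * n)⁻¹ * ∑ l ∈ hs.toFinset, d l t
  -- On the real line `|exp (i l t) - 1|² = 2 - exp (i l t) - exp (-i l t)`, which exhibits `q` as
  -- an exponential sum.
  let D : ℝ → ℂ → ℂ := fun l => (2 : ℂ) • 1 + (-1 : ℂ) • (fun z : ℂ => cexp (I * l * z))
    + (-1 : ℂ) • (fun z : ℂ => cexp (I * ((-l : ℝ) : ℂ) * z))
  let Q : ℂ → ℂ := 1 + (-(4 * n)⁻¹ : ℂ) • ∑ l ∈ hs.toFinset, D l
  have hD : ∀ l t : ℝ, D l t = d l t := fun l t => by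
    have h1 : cexp (I * ((-l : ℝ) : ℂ) * t) = (starRingEnd ℂ) (cexp (I * l * t)) := by
      rw [← Complex.exp_conj]; simp
    have h2 : (starRingEnd ℂ) (cexp (I * l * t)) * cexp (I * l * t) = 1 := by
      rw [Complex.conj_mul', norm_exp_I_mul_ofReal_mul]; simp
    simp only [D, d, Pi.add_apply, Pi.smul_apply, smul_eq_mul, Pi.one_apply, ofReal_pow]
    rw [← Complex.conj_mul', h1, map_sub, map_one]
    linear_combination -h2
  have hd0 : ∀ l t, 0 ≤ d l t := fun l t => by positivity
  have hd4 : ∀ l t, d l t ≤ 4 := fun l t => by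
    have : ‖cexp (I * l * t) - 1‖ ≤ 2 := by
      refine (norm_sub_le _ _).trans ?_
      rw [norm_exp_I_mul_ofReal_mul, norm_one]; norm_num
    calc d l t ≤ 2 ^ 2 := by simp only [d]; gcongr
      _ = 4 := by norm_num
  refine ⟨q, Q, max 0 (1 - (4 * n)⁻¹ * δ ^ 2), ?_, fun t => ?_, ?_, fun t => ⟨?_, ?_⟩, ?_,
    le_max_left _ _, ?_, fun t ht => le_max_of_le_right ?_⟩
  · refine IsExpSum.one.add ((IsExpSum.sum fun l _ => ?_).smul _)
    exact ((IsExpSum.one.smul _).add ((IsExpSum.exp _).smul _)).add ((IsExpSum.exp _).smul _)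
  · simp only [Q, q, Pi.add_apply, Pi.one_apply, Pi.smul_apply, Finset.sum_apply, hD, smul_eq_mul]
    push_cast; ring
  · simp only [q, d]; fun_prop
  · have : ∑ l ∈ hs.toFinset, d l t ≤ 4 * n := by
      calc ∑ l ∈ hs.toFinset, d l t ≤ ∑ l ∈ hs.toFinset, (4 : ℝ) :=
            Finset.sum_le_sum fun l _ => hd4 l t
        _ ≤ 4 * n := by rw [Finset.sum_const, nsmul_eq_mul]; linarith
    have : (4 * n)⁻¹ * ∑ l ∈ hs.toFinset, d l t ≤ 1 := by
      rw [inv_mul_le_iff₀ (by positivity)]; linarith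
    simp only [q]; linarith
  · have : 0 ≤ (4 * n)⁻¹ * ∑ l ∈ hs.toFinset, d l t :=
      mul_nonneg (by positivity) (Finset.sum_nonneg fun l _ => hd0 l t)
    simp only [q]; linarith
  · have h0 : ∀ l ∈ hs.toFinset, Tendsto (d l) bohrFilter (𝓝 0) := fun l _ => by
      simpa [d] using (((tendsto_exp_bohrFilter l).sub_const 1).norm).pow 2
    simpa [q] using ((tendsto_finsetSum _ h0).const_mul (4 * n)⁻¹).const_sub 1
  · rw [max_lt_iff]
    exact ⟨one_pos, by linarith [show 0 < (4 * n)⁻¹ * δ ^ 2 by positivity]⟩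
  · have : ∃ l ∈ s, δ ≤ ‖cexp (I * l * t) - 1‖ := by
      by_contra! hcon
      refine ht (hWV (hsub fun l hl => ?_))
      simpa [dist_eq_norm] using (hcon l hl).trans_le (hδ l hl)
    obtain ⟨l, hl, hle⟩ := this
    have : δ ^ 2 ≤ ∑ l ∈ hs.toFinset, d l t := by
      calc δ ^ 2 ≤ d l t := by simp only [d]; gcongr
        _ ≤ _ := Finset.single_le_sum (f := fun l => d l t) (fun l _ => hd0 l t) (by simpa using hl)
    simp only [q]; gcongr

/-! ### Bohr's approximation theorem -/

/-- The approximant is the limit mean of `f (z + t) k t` divided by the limit mean of `k`. Where `k`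
is large, `f (z + t)` is within `ε` of `f z`; the remainder `η` is divided by a mean of at least
`ν`. -/
theorem exists_approx_of_mean {a b : EReal} {f K : ℂ → ℂ} {k : ℝ → ℝ} {a' b' : ℝ}
    (hd : DifferentiableOn ℂ f (horizontalStrip a b)) (hb : BddOnSubstrips a b f)
    (hs : IsSubstrip a' b' a b) (hK : IsExpSum K) (hKk : ∀ t : ℝ, K t = k t)
    (hk : Continuous k) (hk0 : ∀ t, 0 ≤ k t) {ε η ν : ℝ}
    (hmean : ∀ᶠ T : ℝ in atTop, ν ≤ (2 * T)⁻¹ * ∫ t in (-T)..T, k t)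
    (hle : ∀ z ∈ horizontalStrip (a' : EReal) (b' : EReal), ∀ t : ℝ,
      ‖f (z + t) - f z‖ * k t ≤ ε * k t + η) (hν : 0 < ν) (hη : 0 ≤ η) :
    ∃ p, IsExpSum p ∧ ∀ z ∈ horizontalStrip (a' : EReal) (b' : EReal),
      ‖f z - p z‖ ≤ ε + η / ν := by
  let U : Ultrafilter ℝ := Ultrafilter.of atTop
  have hU : (U : Filter ℝ) ≤ atTop := Ultrafilter.of_le atTop
  obtain ⟨p, hp, hlim⟩ := hK.exists_tendsto_mean_mul hd hb U hU
  let M : ℝ → ℝ := fun T => (2 * T)⁻¹ * ∫ t in (-T)..T, k t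
  have hMC : ∀ T, segmentMean K 0 T = M T := fun T => by
    simp only [segmentMean, M, zero_add, hKk, intervalIntegral.integral_ofReal]
    push_cast; ring
  obtain ⟨c, hc⟩ := exists_tendsto_segmentMean (hK.isBohrAP ⊥ ⊤).differentiableOn
    (hK.isBohrAP ⊥ ⊤).bdd U hU
  have hc := hc 0 (by simp [horizontalStrip])
  have hM : Tendsto M U (𝓝 c.re) := by
    refine ((Complex.continuous_re.tendsto c).comp hc).congr fun T => ?_
    simp [hMC]
  have hMC' : Tendsto (fun T => (M T : ℂ)) U (𝓝 ((c.re : ℝ) : ℂ)) :=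
    (Complex.continuous_ofReal.tendsto _).comp hM
  have hνc : ν ≤ c.re := ge_of_tendsto hM (hU hmean)
  have hc0 : 0 < c.re := hν.trans_le hνc
  refine ⟨((c.re : ℂ)⁻¹) • p, hp.smul _, fun z hz => ?_⟩
  have hf := continuous_comp_add_ofReal hd.continuousOn (hs.subset hz)
  have hK' : Continuous fun t : ℝ => K t := by
    simp only [hKk]; exact Complex.continuous_ofReal.comp hk
  have hbound : ‖p z - f z * c.re‖ ≤ ε * c.re + η := by
    refine le_of_tendsto_of_tendsto ((hlim z (hs.subset hz)).sub (hMC'.const_mul (f z))).norm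
      ((hM.const_mul ε).add_const η) ?_
    filter_upwards [hU (eventually_gt_atTop 0)] with T hT
    have h2T : ‖(2 * T : ℂ)⁻¹‖ = (2 * T)⁻¹ := by
      rw [norm_inv, norm_mul, Complex.norm_real, Real.norm_of_nonneg hT.le]; simp
    have e : (2 * T : ℂ)⁻¹ * (∫ t in (-T)..T, f (z + t) * K t) - f z * M T
        = (2 * T : ℂ)⁻¹ * ∫ t in (-T)..T, (f (z + t) - f z) * K t := by
      have : ∫ t in (-T)..T, (f (z + t) - f z) * K t
          = (∫ t in (-T)..T, f (z + t) * K t) - f z * ∫ t in (-T)..T, K t := by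
        rw [← intervalIntegral.integral_const_mul, ← intervalIntegral.integral_sub]
        · simp only [sub_mul]
        · exact (hf.mul hK').intervalIntegrable _ _
        · exact (continuous_const.mul hK').intervalIntegrable _ _
      rw [this, ← hMC, segmentMean]
      simp only [zero_add]; ring
    have hle' : ‖∫ t in (-T)..T, (f (z + t) - f z) * K t‖ ≤ ∫ t in (-T)..T, (ε * k t + η) := by
      refine intervalIntegral.norm_integral_le_of_norm_le (by linarith) ?_ ?_
      · refine Eventually.of_forall fun t _ => ?_
        rw [norm_mul, hKk, Complex.norm_real, Real.norm_of_nonneg (hk0 t)]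
        exact hle z hz t
      · exact Continuous.intervalIntegrable (by fun_prop) _ _
    have hint : ∫ t in (-T)..T, (ε * k t + η) = ε * (∫ t in (-T)..T, k t) + η * (2 * T) := by
      rw [intervalIntegral.integral_add, intervalIntegral.integral_const_mul,
        intervalIntegral.integral_const, smul_eq_mul]
      · ring
      · exact Continuous.intervalIntegrable (by fun_prop) _ _
      · exact Continuous.intervalIntegrable (by fun_prop) _ _
    rw [e, norm_mul, h2T]
    calc (2 * T)⁻¹ * ‖∫ t in (-T)..T, (f (z + t) - f z) * K t‖
        ≤ (2 * T)⁻¹ * (ε * (∫ t in (-T)..T, k t) + η * (2 * T)) := by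
          rw [← hint]; gcongr
      _ = ε * M T + η := by simp only [M]; field_simp
  have hcC : (c.re : ℂ) ≠ 0 := by exact_mod_cast hc0.ne'
  have e : f z - ((c.re : ℂ)⁻¹ • p) z = -((c.re : ℂ)⁻¹ * (p z - f z * c.re)) := by
    simp only [Pi.smul_apply, smul_eq_mul]; field_simp; ring
  rw [e, norm_neg, norm_mul, norm_inv, Complex.norm_real, Real.norm_of_nonneg hc0.le]
  calc c.re⁻¹ * ‖p z - f z * c.re‖ ≤ c.re⁻¹ * (ε * c.re + η) := by gcongr
    _ = ε + η / c.re := by field_simp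
    _ ≤ ε + η / ν := by gcongr

/-- **Bohr's approximation theorem** on a strip. -/
theorem IsBohrAP.isAnalyticAP {a b : EReal} {f : ℂ → ℂ} (hf : IsBohrAP a b f) :
    IsAnalyticAP a b f := by
  intro a' b' hs ε hε
  obtain ⟨C, hC0, hC⟩ := hf.bdd.exists_pos hs
  have hV := Metric.tendstoUniformlyOn_iff.1 (hf.unif a' b' hs) (ε / 3) (by positivity)
  obtain ⟨q, Q, α, hQ, hQq, hqc, hq, hq1, hα0, hα1, hqα⟩ := exists_kernel hV
  -- With `α < β < 1`, the mean of `q ^ N` is at least of order `β ^ N`, as `{q > β}` is relatively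
  -- dense, while off the almost periods `q ^ N ≤ α ^ N`. The ratio is beaten by taking `N` large.
  obtain ⟨β, hβ⟩ : ∃ β, β = (1 + α) / 2 := ⟨_, rfl⟩
  have hαβ : α < β := by rw [hβ]; linarith
  have hβ1 : β < 1 := by rw [hβ]; linarith
  have hβ0 : 0 < β := by rw [hβ]; linarith
  obtain ⟨F, hF⟩ := exists_finset_translates ((tendsto_order.1 hq1).1 β hβ1)
  have hFne : F.Nonempty := by
    obtain ⟨s, hs, -⟩ := hF 0
    exact ⟨s, hs⟩
  set m : ℝ := (F.card : ℝ) with hm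
  have hm0 : 0 < m := by rw [hm]; exact_mod_cast hFne.card_pos
  obtain ⟨N, hN⟩ := exists_pow_lt_of_lt_one (show 0 < ε / 3 / (4 * C * m) by positivity)
    (show α / β < 1 by rwa [div_lt_one hβ0])
  have hmean : ∀ᶠ T : ℝ in atTop,
      β ^ N / (2 * m) ≤ (2 * T)⁻¹ * ∫ t in (-T)..T, q t ^ N := by
    have hQN := (hQ.pow N).isBohrAP ⊥ ⊤
    have hre : ∀ (s T : ℝ), (segmentMean (Q ^ N) ((-s : ℝ) : ℂ) T).re
        = (2 * T)⁻¹ * ∫ t in (-T)..T, q (t - s) ^ N := fun s T => by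
      have : segmentMean (Q ^ N) ((-s : ℝ) : ℂ) T
          = (((2 * T)⁻¹ * ∫ t in (-T)..T, q (t - s) ^ N : ℝ) : ℂ) := by
        have e : ∀ t : ℝ, (Q ^ N) (((-s : ℝ) : ℂ) + t) = ((q (t - s) ^ N : ℝ) : ℂ) := fun t => by
          rw [Pi.pow_apply, ← ofReal_add, hQq, neg_add_eq_sub]; push_cast; rfl
        simp only [segmentMean, e, intervalIntegral.integral_ofReal]
        push_cast; ring
      rw [this, ofReal_re]
    have hS : ∀ s : ℝ, (s : ℂ) ∈ horizontalStrip ⊥ ⊤ := fun s => by simp [horizontalStrip]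
    have hlim : ∀ s ∈ F, Tendsto (fun T => (segmentMean (Q ^ N) ((-s : ℝ) : ℂ) T
        - segmentMean (Q ^ N) ((-(0 : ℝ) : ℝ) : ℂ) T).re) atTop (𝓝 0) := fun s _ => by
      have := tendsto_segmentMean_sub hQN.differentiableOn hQN.bdd (hS (-s)) (hS (-0))
      exact (Complex.continuous_re.tendsto 0).comp this
    have hsum := tendsto_finsetSum F hlim
    rw [Finset.sum_const_zero] at hsum
    -- The means of the `m` translates of `q ^ N` are asymptotically equal and add up to at least `β
    -- ^ N`; the slack `β ^ N / 2` accounts for the factor `2` in `β ^ N / (2 * m)`.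
    filter_upwards [(tendsto_order.1 hsum).2 (β ^ N / 2) (by positivity), eventually_gt_atTop 0]
      with T hT hT0
    simp only [Complex.sub_re, hre, sub_zero, Finset.sum_sub_distrib, Finset.sum_const,
      nsmul_eq_mul] at hT
    have hlow : β ^ N ≤ ∑ s ∈ F, (2 * T)⁻¹ * ∫ t in (-T)..T, q (t - s) ^ N := by
      rw [← Finset.mul_sum, ← intervalIntegral.integral_finsetSum]
      · have h1 : ∫ _ in (-T)..T, β ^ N ≤ ∫ t in (-T)..T, ∑ s ∈ F, q (t - s) ^ N := by
          refine intervalIntegral.integral_mono (by linarith) ?_ ?_ fun t => ?_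
          · exact Continuous.intervalIntegrable (by fun_prop) _ _
          · exact Continuous.intervalIntegrable (by fun_prop) _ _
          · obtain ⟨s, hs, hts⟩ := hF t
            calc β ^ N ≤ q (t - s) ^ N := by
                  have : β < q (t - s) := hts
                  gcongr
              _ ≤ _ := Finset.single_le_sum (f := fun s => q (t - s) ^ N)
                  (fun s _ => pow_nonneg (hq _).1 N) hs
        rw [intervalIntegral.integral_const, smul_eq_mul] at h1
        rw [le_inv_mul_iff₀ (by positivity)]
        linarith
      · intro s _
        exact Continuous.intervalIntegrable (by fun_prop) _ _
    rw [div_le_iff₀ (by positivity)]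
    rw [← hm] at hT
    linarith
  obtain ⟨p, hp, hfp⟩ := exists_approx_of_mean (k := fun t => q t ^ N) (ε := ε / 3)
    (η := 2 * C * α ^ N)
    hf.differentiableOn hf.bdd hs (hQ.pow N)
    (fun t => by rw [Pi.pow_apply, hQq]; push_cast; rfl) (hqc.pow N)
    (fun t => pow_nonneg (hq t).1 N) hmean (fun z hz t => by
      by_cases ht : ∀ z ∈ horizontalStrip (a' : EReal) (b' : EReal), dist (f z) (f (z + t)) < ε / 3
      · have h1 := ht z hz
        rw [dist_comm, dist_eq_norm] at h1
        have h2 := mul_le_mul_of_nonneg_right h1.le (pow_nonneg (hq t).1 N)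
        have : 0 ≤ 2 * C * α ^ N := by positivity
        linarith
      · have h1 : ‖f (z + t) - f z‖ ≤ 2 * C := (norm_sub_le _ _).trans (by
          linarith [hC z hz, hC _ (add_ofReal_mem_horizontalStrip hz t)])
        have h2 : q t ^ N ≤ α ^ N := pow_le_pow_left₀ (hq t).1 (hqα t ht) N
        have h3 : 0 ≤ ε / 3 * q t ^ N := mul_nonneg (by positivity) (pow_nonneg (hq t).1 N)
        have h4 : ‖f (z + t) - f z‖ * q t ^ N ≤ 2 * C * α ^ N :=
          mul_le_mul h1 h2 (pow_nonneg (hq t).1 N) (by positivity)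
        linarith) (by positivity) (by positivity)
  refine ⟨p, hp, fun z hz => (hfp z hz).trans_lt ?_⟩
  have : 2 * C * α ^ N / (β ^ N / (2 * m)) = (α / β) ^ N * (4 * C * m) := by
    rw [div_pow]; field_simp; ring
  rw [this]
  rw [lt_div_iff₀ (by positivity)] at hN
  linarith

/-! ### Limits of translates along ultrafilters -/

/-- Bounded values converge pointwise along an ultrafilter, and the Schwarz lemma supplies the
equicontinuity that makes the convergence locally uniform. -/
theorem tendstoLocallyUniformlyOn_of_norm_le {ι : Type*} (U : Ultrafilter ι) {F : ι → ℂ → ℂ}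
    {S : Set ℂ} (hd : ∀ i, DifferentiableOn ℂ (F i) S)
    (hb : ∀ z ∈ S, ∃ r > 0, ∃ C, Metric.ball z r ⊆ S ∧ ∀ i, ∀ w ∈ Metric.ball z r, ‖F i w‖ ≤ C) :
    ∃ G, TendstoLocallyUniformlyOn F G U S := by
  have hlim : ∀ z, ∃ c, z ∈ S → Tendsto (fun i => F i z) U (𝓝 c) := fun z => by
    by_cases hz : z ∈ S
    · obtain ⟨r, hr, C, -, hC⟩ := hb z hz
      obtain ⟨c, -, hc⟩ := exists_tendsto_of_norm_le U (g := fun i => F i z) (C := C)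
        (Eventually.of_forall fun i => hC i z (Metric.mem_ball_self hr))
      exact ⟨c, fun _ => hc⟩
    · exact ⟨0, fun h => absurd h hz⟩
  choose G hG using hlim
  refine ⟨G, Metric.tendstoLocallyUniformlyOn_iff.2 fun ε hε z hz => ?_⟩
  obtain ⟨r, hr, C, hsub, hC⟩ := hb z hz
  set D := 2 * |C| + 1 with hD
  have hD0 : 0 < D := by positivity
  have hlip : ∀ i, ∀ w ∈ Metric.ball z r, dist (F i w) (F i z) ≤ D / r * dist w z := fun i w hw => by
    refine Complex.dist_le_div_mul_dist_of_mapsTo_ball ((hd i).mono hsub) (fun v hv => ?_) hw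
    rw [Metric.mem_closedBall, dist_eq_norm]
    have h1 := hC i v hv
    have h2 := hC i z (Metric.mem_ball_self hr)
    have := norm_sub_le (F i v) (F i z)
    linarith [le_abs_self C]
  set ρ := min r (ε * r / (4 * D)) with hρ
  have hρ0 : 0 < ρ := by positivity
  have hequi : ∀ i, ∀ w ∈ Metric.ball z ρ, dist (F i w) (F i z) ≤ ε / 4 := fun i w hw => by
    have hw1 := Metric.ball_subset_ball (min_le_left _ _) hw
    have hw2 : dist w z ≤ ε * r / (4 * D) := (Metric.mem_ball.1 hw).le.trans (min_le_right _ _)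
    calc _ ≤ D / r * dist w z := hlip i w hw1
      _ ≤ D / r * (ε * r / (4 * D)) := by gcongr
      _ = ε / 4 := by field_simp
  refine ⟨Metric.ball z ρ, mem_nhdsWithin_of_mem_nhds (Metric.ball_mem_nhds z hρ0), ?_⟩
  filter_upwards [Metric.tendsto_nhds.1 (hG z hz) (ε / 4) (by positivity)] with i hi w hw
  have hwS : w ∈ S := hsub (Metric.ball_subset_ball (min_le_left _ _) hw)
  have h1 : dist (G w) (G z) ≤ ε / 4 := le_of_tendsto ((hG w hwS).dist (hG z hz))
    (Eventually.of_forall fun j => hequi j w hw)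
  have h2 := hequi i w hw
  have := dist_triangle4 (G w) (G z) (F i z) (F i w)
  rw [dist_comm (G z) (F i z), dist_comm (F i z) (F i w)] at this
  linarith

theorem BddOnSubstrips.exists_bound_ball {a b : EReal} {f : ℂ → ℂ} (hf : BddOnSubstrips a b f)
    {z : ℂ} (hz : z ∈ horizontalStrip a b) :
    ∃ r > 0, ∃ C, Metric.ball z r ⊆ horizontalStrip a b ∧
      ∀ t : ℝ, ∀ w ∈ Metric.ball z r, ‖f (w + t)‖ ≤ C := by
  obtain ⟨a', b', hs, hz'⟩ := exists_substrip_mem hz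
  obtain ⟨C, hC⟩ := hf a' b' hs
  obtain ⟨r, hr, hsub⟩ := Metric.isOpen_iff.1 (isOpen_horizontalStrip _ _) z hz'
  exact ⟨r, hr, C, hsub.trans hs.subset, fun t w hw =>
    hC _ (add_ofReal_mem_horizontalStrip (hsub hw) t)⟩

theorem differentiableOn_translate {a b : EReal} {f : ℂ → ℂ}
    (hd : DifferentiableOn ℂ f (horizontalStrip a b)) (t : ℝ) :
    DifferentiableOn ℂ (fun z => f (z + t)) (horizontalStrip a b) :=
  hd.comp (by fun_prop) fun _ hz => add_ofReal_mem_horizontalStrip hz t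

/-- **Montel's theorem** for translates, along an ultrafilter. -/
theorem BddOnSubstrips.exists_limit_translates {a b : EReal} {f : ℂ → ℂ}
    (hb : BddOnSubstrips a b f) (hd : DifferentiableOn ℂ f (horizontalStrip a b))
    {ι : Type*} (U : Ultrafilter ι) (x : ι → ℝ) :
    ∃ g, DifferentiableOn ℂ g (horizontalStrip a b) ∧
      TendstoLocallyUniformlyOn (fun i z => f (z + x i)) g U (horizontalStrip a b) := by
  obtain ⟨g, hg⟩ := tendstoLocallyUniformlyOn_of_norm_le U
    (fun i => differentiableOn_translate hd (x i)) fun z hz => by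
      obtain ⟨r, hr, C, hsub, hC⟩ := hb.exists_bound_ball hz
      exact ⟨r, hr, C, hsub, fun i => hC (x i)⟩
  exact ⟨g, hg.differentiableOn (Eventually.of_forall fun i => differentiableOn_translate hd (x i))
    (isOpen_horizontalStrip a b), hg⟩

namespace IsBohrAP

variable {a b : EReal} {f g : ℂ → ℂ}

/-- The translates of an almost periodic function converge uniformly along ultrafilters. -/
theorem exists_limit_translates (hf : IsBohrAP a b f) {ι : Type*} (U : Ultrafilter ι)
    (x : ι → ℝ) :
    ∃ g, DifferentiableOn ℂ g (horizontalStrip a b) ∧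
      ∀ a' b' : ℝ, IsSubstrip a' b' a b → TendstoUniformlyOn (fun i z => f (z + x i)) g U
        (horizontalStrip (a' : EReal) (b' : EReal)) := by
  obtain ⟨g, hg, hlim⟩ := hf.bdd.exists_limit_translates hf.differentiableOn U x
  refine ⟨g, hg, fun a' b' hs => UniformCauchySeqOn.tendstoUniformlyOn_of_tendsto ?_
    fun z hz => hlim.tendsto_at (hs.subset hz)⟩
  intro u hu
  -- The differences `x i - x j` are eventually almost periods, and substrips are invariant under
  -- real shifts, so the translates are uniformly Cauchy.
  filter_upwards [(tendsto_sub_bohrFilter U x).eventually (hf.unif a' b' hs _ (symm_le_uniformity hu))]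
    with q hq z hz
  have := hq _ (add_ofReal_mem_horizontalStrip hz (x q.2))
  simpa [add_assoc] using this

/-- Uniformity on the whole substrip matters: it allows evaluation at the moving points `w - x i`,
which brings the smallness back to `f w`. -/
theorem _root_.eq_zero_of_limit_translates {ι : Type*} {p : Filter ι} [p.NeBot] {x : ι → ℝ}
    (hg : DifferentiableOn ℂ g (horizontalStrip a b))
    (hlim : ∀ a' b' : ℝ, IsSubstrip a' b' a b → TendstoUniformlyOn (fun i z => f (z + x i)) g p
        (horizontalStrip (a' : EReal) (b' : EReal)))
    {z : ℂ} (hz : z ∈ horizontalStrip a b) (h0 : ∀ᶠ w in 𝓝 z, g w = 0) :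
    ∀ w ∈ horizontalStrip a b, f w = 0 := by
  have hg0 := eqOn_horizontalStrip hg (differentiableOn_const 0) hz h0
  intro w hw
  by_contra hne
  obtain ⟨a', b', hs, hw'⟩ := exists_substrip_mem hw
  obtain ⟨i, hi⟩ := (Metric.tendstoUniformlyOn_iff.1 (hlim a' b' hs) ‖f w‖
    (norm_pos_iff.2 hne)).exists
  have hmem := add_ofReal_mem_horizontalStrip hw' (-x i)
  have := hi _ hmem
  rw [hg0 (hs.subset hmem)] at this
  simp at this

/-- An almost periodic function that is not identically zero is bounded away from zero somewhere
in every horizontal translate of a given ball. -/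
theorem exists_lower_bound (hf : IsBohrAP a b f) (hne : ∃ z ∈ horizontalStrip a b, f z ≠ 0)
    {K : Set ℂ} {z₀ : ℂ} (hz₀ : z₀ ∈ horizontalStrip a b) (hK : K ∈ 𝓝 z₀) :
    ∃ η > 0, ∀ s : ℝ, ∃ z ∈ K, η ≤ ‖f (z + s)‖ := by
  by_contra! hcon
  choose s hs using fun n : ℕ => hcon (1 / ((n : ℝ) + 1)) (by positivity)
  let U := hyperfilter ℕ
  have hU : (U : Filter ℕ) ≤ atTop := Nat.cofinite_eq_atTop ▸ hyperfilter_le_cofinite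
  obtain ⟨g, hg, hlim⟩ := hf.exists_limit_translates U s
  have hloc := tendstoLocallyUniformlyOn_horizontalStrip hlim
  have h0 : ∀ᶠ w in 𝓝 z₀, g w = 0 := by
    filter_upwards [hK, (isOpen_horizontalStrip a b).mem_nhds hz₀] with w hwK hwS
    refine tendsto_nhds_unique (hloc.tendsto_at hwS) ?_
    refine squeeze_zero_norm (fun n => (hs n w hwK).le) ?_
    exact tendsto_one_div_add_atTop_nhds_zero_nat.mono_left hU
  obtain ⟨z, hz, hfz⟩ := hne
  exact hfz (eq_zero_of_limit_translates hg hlim hz₀ h0 z hz)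

end IsBohrAP

/-! ### Roots of separable equations with almost periodic coefficients -/

theorem Filter.Frequently.exists_ultrafilter_le {ι : Type*} {p : Filter ι} {P : ι → Prop}
    (h : ∃ᶠ i in p, P i) : ∃ U : Ultrafilter ι, (U : Filter ι) ≤ p ∧ ∀ᶠ i in (U : Filter ι), P i := by
  have : (p ⊓ 𝓟 {i | P i}).NeBot := inf_principal_neBot_iff.2 fun s hs => by
    obtain ⟨i, hi, his⟩ := (h.and_eventually hs).exists
    exact ⟨i, his, hi⟩
  have hle := Ultrafilter.of_le (p ⊓ 𝓟 {i | P i})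
  exact ⟨Ultrafilter.of (p ⊓ 𝓟 {i | P i}), hle.trans inf_le_left,
    (hle.trans inf_le_right) (mem_principal_self _)⟩

theorem exists_norm_pow_sub_pow_le (M : ℝ) (i : ℕ) :
    ∃ L, 0 ≤ L ∧ ∀ u v : ℂ, ‖u‖ ≤ M → ‖v‖ ≤ M → ‖u ^ i - v ^ i‖ ≤ L * ‖u - v‖ := by
  induction i with
  | zero => exact ⟨0, le_rfl, fun u v _ _ => by simp⟩
  | succ i ih =>
    obtain ⟨L, hL0, hL⟩ := ih
    refine ⟨L * |M| + |M| ^ i, by positivity, fun u v hu hv => ?_⟩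
    have hu' := hu.trans (le_abs_self M)
    have hv' := hv.trans (le_abs_self M)
    calc ‖u ^ (i + 1) - v ^ (i + 1)‖ = ‖(u ^ i - v ^ i) * u + v ^ i * (u - v)‖ := by ring_nf
      _ ≤ ‖u ^ i - v ^ i‖ * ‖u‖ + ‖v‖ ^ i * ‖u - v‖ := by
        refine (norm_add_le _ _).trans (by rw [norm_mul, norm_mul, norm_pow])
      _ ≤ (L * ‖u - v‖) * |M| + |M| ^ i * ‖u - v‖ := by gcongr; exact hL u v hu hv
      _ = _ := by ring

/-- Two distinct roots `u`, `v` of a polynomial with bounded coefficients are apart by a multiple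
of the derivative at `v`. -/
theorem exists_norm_derivative_le_of_roots (n : ℕ) (M : ℝ) :
    ∃ L, 0 < L ∧ ∀ (c : ℕ → ℂ) (u v : ℂ), (∀ j ∈ Finset.range (n + 1), ‖c j‖ ≤ M) → ‖u‖ ≤ M →
      ‖v‖ ≤ M → ∑ j ∈ Finset.range (n + 1), c j * u ^ j = 0 →
      ∑ j ∈ Finset.range (n + 1), c j * v ^ j = 0 → u ≠ v →
      ‖∑ j ∈ Finset.range (n + 1), c j * (j * v ^ (j - 1))‖ ≤ L * ‖u - v‖ := by
  choose L hL0 hL using exists_norm_pow_sub_pow_le M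
  let B : ℝ := ∑ j ∈ Finset.range (n + 1), |M| * ∑ i ∈ Finset.range j, L i * |M| ^ (j - 1 - i)
  have hB : 0 ≤ B := Finset.sum_nonneg fun j _ => mul_nonneg (abs_nonneg _)
    (Finset.sum_nonneg fun i _ => mul_nonneg (hL0 i) (by positivity))
  refine ⟨B + 1, by linarith, fun c u v hc hu hv h1 h2 huv => ?_⟩
  -- The divided difference of the polynomial vanishes at two distinct roots. The derivative at `v`
  -- is its value on the diagonal, so it differs from zero by `O(|u - v|)`.
  have hΦ : ∑ j ∈ Finset.range (n + 1), c j * ∑ i ∈ Finset.range j, u ^ i * v ^ (j - 1 - i) = 0 := by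
    refine (mul_eq_zero.1 (?_ : _ * (u - v) = 0)).resolve_right (sub_ne_zero.2 huv)
    simp only [Finset.sum_mul, mul_assoc]
    simp only [← Finset.sum_mul, geom_sum₂_mul, ← mul_assoc]
    calc _ = ∑ j ∈ Finset.range (n + 1), (c j * u ^ j - c j * v ^ j) :=
          Finset.sum_congr rfl fun j _ => by
            rw [← mul_sub, ← geom_sum₂_mul, Finset.sum_mul]
      _ = 0 := by rw [Finset.sum_sub_distrib, h1, h2, sub_zero]
  have hself : ∀ j : ℕ, (j * v ^ (j - 1) : ℂ)
      = ∑ i ∈ Finset.range j, v ^ i * v ^ (j - 1 - i) := fun j => by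
    rw [Finset.sum_congr rfl (g := fun _ => v ^ (j - 1)), Finset.sum_const, Finset.card_range,
      nsmul_eq_mul]
    intro i hi
    rw [← pow_add]
    congr 1
    have := Finset.mem_range.1 hi
    omega
  have e : ∑ j ∈ Finset.range (n + 1), c j * (j * v ^ (j - 1))
      = -∑ j ∈ Finset.range (n + 1), c j * ∑ i ∈ Finset.range j,
        (u ^ i - v ^ i) * v ^ (j - 1 - i) := by
    simp only [hself, sub_mul, Finset.sum_sub_distrib, mul_sub, hΦ]
    ring
  rw [e, norm_neg]
  calc _ ≤ ∑ j ∈ Finset.range (n + 1), |M| * ∑ i ∈ Finset.range j,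
        (L i * ‖u - v‖) * |M| ^ (j - 1 - i) := by
        refine norm_sum_le_of_le _ fun j hj => ?_
        rw [norm_mul]
        refine mul_le_mul ((hc j hj).trans (le_abs_self M)) ?_ (norm_nonneg _) (abs_nonneg _)
        refine norm_sum_le_of_le _ fun i _ => ?_
        rw [norm_mul, norm_pow]
        gcongr
        · exact mul_nonneg (hL0 i) (norm_nonneg _)
        · exact hL i u v hu hv
        · exact hv.trans (le_abs_self M)
    _ = B * ‖u - v‖ := by
        simp only [B, Finset.sum_mul, mul_assoc, Finset.mul_sum]
        refine Finset.sum_congr rfl fun j _ => Finset.sum_congr rfl fun i _ => by ring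
    _ ≤ (B + 1) * ‖u - v‖ := by gcongr; linarith

theorem exists_eq_of_roots {n : ℕ} {c v : ℕ → ℂ} {j₀ : ℕ} (hj₀ : j₀ ≤ n) (hc : c j₀ ≠ 0)
    (hv : ∀ i ≤ n, ∑ j ∈ Finset.range (n + 1), c j * v i ^ j = 0) :
    ∃ i k, i < k ∧ k ≤ n ∧ v i = v k := by
  by_contra! hcon
  let p : Polynomial ℂ := ∑ j ∈ Finset.range (n + 1), Polynomial.C (c j) * Polynomial.X ^ j
  have hp : p = 0 := by
    refine Polynomial.eq_zero_of_natDegree_lt_card_of_eval_eq_zero p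
      (f := fun i : Fin (n + 1) => v i) ?_ (fun i => ?_) ?_
    · intro i k hik
      by_contra hne
      rcases lt_or_gt_of_ne (fun h => hne (Fin.ext h) : (i : ℕ) ≠ k) with h | h
      · exact hcon i k h (by omega) hik
      · exact hcon k i h (by omega) hik.symm
    · simpa [p, Polynomial.eval_finsetSum] using hv i (by omega)
    · rw [Fintype.card_fin, Nat.lt_succ_iff]
      refine Polynomial.natDegree_sum_le_of_forall_le _ _ fun j hj => ?_
      exact (Polynomial.natDegree_C_mul_X_pow_le _ _).trans (by simpa [Nat.lt_succ_iff] using hj)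
  have : p.coeff j₀ = c j₀ := by
    simp [p, Polynomial.coeff_C_mul, Polynomial.coeff_X_pow, hj₀]
  rw [hp] at this
  exact hc (by simpa using this.symm)

/-- Almost periods act uniformly in the base point. Hence Bohr-null shifts do not change limits of
the coefficients, and shifted roots satisfy the same limit equation. -/
theorem IsBohrAP.tendsto_translate {a b : EReal} {f : ℂ → ℂ} (hf : IsBohrAP a b f) {ι : Type*}
    {p : Filter ι} {s t : ι → ℝ} (ht : Tendsto t p bohrFilter) {z : ℂ}
    (hz : z ∈ horizontalStrip a b) {c : ℂ} (h : Tendsto (fun i => f (z + s i)) p (𝓝 c)) :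
    Tendsto (fun i => f (z + (s i + t i : ℝ))) p (𝓝 c) := by
  obtain ⟨a', b', hs, hz'⟩ := exists_substrip_mem hz
  have h0 : Tendsto (fun i => f (z + (s i + t i : ℝ)) - f (z + s i)) p (𝓝 0) := by
    rw [Metric.tendsto_nhds]
    intro ε hε
    filter_upwards [ht.eventually (Metric.tendstoUniformlyOn_iff.1 (hf.unif a' b' hs) ε hε)] with i hi
    have := hi _ (add_ofReal_mem_horizontalStrip hz' (s i))
    rwa [dist_zero_right, ← dist_eq_norm, dist_comm, ofReal_add, ← add_assoc]
  simpa using h0.add h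

/-- `W` is holomorphic on a strip, bounded on substrips, and a root of a polynomial with almost
periodic coefficients `A j`, such that the derivative of the polynomial at `W` is bounded below on
substrips by a multiple of an almost periodic function `d`, not identically zero. -/
structure IsSeparableRoot (a b : EReal) (n : ℕ) (A : ℕ → ℂ → ℂ) (d W : ℂ → ℂ) : Prop where
  coeff : ∀ j, IsBohrAP a b (A j)
  differentiableOn : DifferentiableOn ℂ W (horizontalStrip a b)
  bdd : BddOnSubstrips a b W
  root : ∀ z ∈ horizontalStrip a b, ∑ j ∈ Finset.range (n + 1), A j z * W z ^ j = 0
  coeff_ne_zero : ∃ j ≤ n, ∃ z ∈ horizontalStrip a b, A j z ≠ 0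
  minorant : IsBohrAP a b d
  minorant_ne_zero : ∃ z ∈ horizontalStrip a b, d z ≠ 0
  minorant_le : ∀ a' b' : ℝ, IsSubstrip a' b' a b → ∃ C, 0 < C ∧
    ∀ z ∈ horizontalStrip (a' : EReal) (b' : EReal),
      ‖d z‖ ≤ C * ‖∑ j ∈ Finset.range (n + 1), A j z * (j * W z ^ (j - 1))‖

namespace IsSeparableRoot

variable {a b : EReal} {n : ℕ} {A : ℕ → ℂ → ℂ} {d W : ℂ → ℂ}

theorem root_of_tendsto (h : IsSeparableRoot a b n A d W) {ι : Type*} {p : Filter ι} [p.NeBot]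
    {x : ι → ℝ} {z : ℂ} (hz : z ∈ horizontalStrip a b) {c : ℕ → ℂ} {v : ℂ}
    (hc : ∀ j, Tendsto (fun i => A j (z + x i)) p (𝓝 (c j)))
    (hv : Tendsto (fun i => W (z + x i)) p (𝓝 v)) :
    ∑ j ∈ Finset.range (n + 1), c j * v ^ j = 0 := by
  have hlim := tendsto_finsetSum (Finset.range (n + 1)) fun j _ => (hc j).mul (hv.pow j)
  refine tendsto_nhds_unique hlim (tendsto_const_nhds.congr fun i => ?_)
  exact (h.root _ (add_ofReal_mem_horizontalStrip hz (x i))).symm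

/-- Two translates of `W` by reals that are close in the Bohr topology are either close on every
compact set or apart from each other on `K`. -/
theorem exists_gap (h : IsSeparableRoot a b n A d W) {K : Set ℂ} (hKc : IsCompact K)
    (hKS : K ⊆ horizontalStrip a b) {z₀ : ℂ} (hK : K ∈ 𝓝 z₀) :
    ∃ ε₀ > 0, ∀ K' : Set ℂ, IsCompact K' → K' ⊆ horizontalStrip a b → ∀ ε > 0,
      ∀ᶠ t : ℝ in bohrFilter, ∀ s : ℝ,
        (∀ z ∈ K, ‖W (z + (s + t : ℝ)) - W (z + s)‖ ≤ ε₀) →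
        ∀ z ∈ K', ‖W (z + (s + t : ℝ)) - W (z + s)‖ < ε := by
  have hz₀ : z₀ ∈ K := mem_of_mem_nhds hK
  obtain ⟨a', b', hs, hsub⟩ := exists_substrip_of_isCompact hKc ⟨z₀, hz₀⟩ hKS
  obtain ⟨η, hη, hlow⟩ := h.minorant.exists_lower_bound h.minorant_ne_zero (hKS hz₀) hK
  obtain ⟨C, hC0, hC⟩ := h.minorant_le a' b' hs
  obtain ⟨M, hMA, hMW⟩ : ∃ M, (∀ j ∈ Finset.range (n + 1),
      ∀ z ∈ horizontalStrip (a' : EReal) (b' : EReal), ‖A j z‖ ≤ M) ∧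
      ∀ z ∈ horizontalStrip (a' : EReal) (b' : EReal), ‖W z‖ ≤ M := by
    choose B hB using fun j => (h.coeff j).bdd.exists_pos hs
    obtain ⟨B', hB'0, hB'⟩ := h.bdd.exists_pos hs
    have hs0 : 0 ≤ ∑ j ∈ Finset.range (n + 1), B j := Finset.sum_nonneg fun j _ => (hB j).1.le
    refine ⟨∑ j ∈ Finset.range (n + 1), B j + B', fun j hj z hz => ?_, fun z hz => ?_⟩
    · have := Finset.single_le_sum (f := B) (fun j _ => (hB j).1.le) hj
      linarith [(hB j).2 z hz]
    · linarith [hB' z hz]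
  obtain ⟨L, hL0, hL⟩ := exists_norm_derivative_le_of_roots n M
  -- Chosen so that `C * (L * (2 * ε₀)) = η / 4`, independently of `K'` and `ε`.
  refine ⟨η / (8 * C * L), by positivity, fun K' hK'c hK'S ε hε => ?_⟩
  set ε₀ := η / (8 * C * L) with hε₀
  by_contra hcon
  obtain ⟨U, hU, hbad⟩ := (Filter.not_eventually.1 hcon).exists_ultrafilter_le
  push Not at hbad
  obtain ⟨s, hs'⟩ := hbad.choice
  obtain ⟨W₁, hW₁, hlim₁⟩ := h.bdd.exists_limit_translates h.differentiableOn U s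
  obtain ⟨W₂, hW₂, hlim₂⟩ := h.bdd.exists_limit_translates h.differentiableOn U (fun t => s t + t)
  choose A' hA' hlimA using fun j => (h.coeff j).exists_limit_translates U s
  obtain ⟨d', hd', hlimd⟩ := h.minorant.exists_limit_translates U s
  have hlimA₁ : ∀ z ∈ horizontalStrip a b, ∀ j, Tendsto (fun t => A j (z + s t)) U (𝓝 (A' j z)) :=
    fun z hz j => (tendstoLocallyUniformlyOn_horizontalStrip (hlimA j)).tendsto_at hz
  have hlimA₂ : ∀ z ∈ horizontalStrip a b, ∀ j,
      Tendsto (fun t => A j (z + (s t + t : ℝ))) U (𝓝 (A' j z)) :=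
    fun z hz j => (h.coeff j).tendsto_translate hU hz (hlimA₁ z hz j)
  have hclose : ∀ z ∈ K, ‖W₂ z - W₁ z‖ ≤ ε₀ := fun z hz =>
    le_of_tendsto ((hlim₂.tendsto_at (hKS hz)).sub (hlim₁.tendsto_at (hKS hz))).norm
      (hs'.mono fun t ht => ht.1 z hz)
  obtain ⟨z₁, hz₁K, hz₁⟩ : ∃ z ∈ K, η / 2 ≤ ‖d' z‖ := by
    obtain ⟨t, ht⟩ := (Metric.tendstoUniformlyOn_iff.1 (hlimd a' b' hs) (η / 2)
      (by positivity)).exists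
    obtain ⟨z, hz, hηz⟩ := hlow (s t)
    refine ⟨z, hz, ?_⟩
    have h1 := ht z (hsub hz)
    rw [dist_comm, dist_eq_norm] at h1
    have := norm_sub_norm_le (d (z + s t)) (d' z)
    linarith
  have hSnhds := (isOpen_horizontalStrip a b).mem_nhds (hKS hz₁K)
  have hsnhds := (isOpen_horizontalStrip (a' : EReal) (b' : EReal)).mem_nhds (hsub hz₁K)
  -- Both limits are roots of one limit polynomial and differ by less than `2 * ε₀` near `z₁`.
  -- Distinct values would force `‖d'‖ ≤ η / 4`, but `‖d'‖` exceeds `η / 4` there.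
  have heq : W₂ =ᶠ[𝓝 z₁] W₁ := by
    have hcont : ContinuousAt (fun z => ‖W₂ z - W₁ z‖) z₁ :=
      ((hW₂.sub hW₁).continuousOn.continuousAt hSnhds).norm
    have hcontd : ContinuousAt (fun z => ‖d' z‖) z₁ := (hd'.continuousOn.continuousAt hSnhds).norm
    have hε₀0 : 0 < ε₀ := by positivity
    filter_upwards [hcont.eventually (gt_mem_nhds (show ‖W₂ z₁ - W₁ z₁‖ < 2 * ε₀ by
        linarith [hclose z₁ hz₁K])),
      hcontd.eventually (lt_mem_nhds (show η / 4 < ‖d' z₁‖ by linarith)), hsnhds] with z hz2 hzd hz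
    have hzS := hs.subset hz
    by_contra hne
    have hW1 := hlim₁.tendsto_at hzS
    have hW2 := hlim₂.tendsto_at hzS
    have hb : ∀ t : ℝ, ‖d (z + s t)‖
        ≤ C * ‖∑ j ∈ Finset.range (n + 1), A j (z + s t) * (j * W (z + s t) ^ (j - 1))‖ := fun t =>
      hC _ (add_ofReal_mem_horizontalStrip hz (s t))
    have hb' : ‖d' z‖ ≤ C * ‖∑ j ∈ Finset.range (n + 1), A' j z * (j * W₁ z ^ (j - 1))‖ := by
      refine le_of_tendsto_of_tendsto' (b := (U : Filter ℝ)) ?_ ?_ hb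
      · exact ((tendstoLocallyUniformlyOn_horizontalStrip hlimd).tendsto_at hzS).norm
      · exact ((tendsto_finsetSum _ fun j _ =>
          (hlimA₁ z hzS j).mul ((hW1.pow (j - 1)).const_mul (j : ℂ))).norm).const_mul C
    have key := hL (fun j => A' j z) (W₂ z) (W₁ z)
      (fun j hj => le_of_tendsto (hlimA₁ z hzS j).norm (Eventually.of_forall fun t =>
        hMA j hj _ (add_ofReal_mem_horizontalStrip hz _)))
      (le_of_tendsto hW2.norm (Eventually.of_forall fun t =>
        hMW _ (add_ofReal_mem_horizontalStrip hz _)))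
      (le_of_tendsto hW1.norm (Eventually.of_forall fun t =>
        hMW _ (add_ofReal_mem_horizontalStrip hz _)))
      (h.root_of_tendsto hzS (hlimA₂ z hzS) hW2) (h.root_of_tendsto hzS (hlimA₁ z hzS) hW1) hne
    have : η / 4 < η / 4 := by
      calc η / 4 < ‖d' z‖ := hzd
        _ ≤ C * (L * ‖W₂ z - W₁ z‖) := hb'.trans (by gcongr)
        _ ≤ C * (L * (2 * ε₀)) := by gcongr
        _ = η / 4 := by rw [hε₀]; field_simp; norm_num
    exact lt_irrefl _ this
  have hE := eqOn_horizontalStrip hW₂ hW₁ (hKS hz₁K) heq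
  have hu₁ := Metric.tendstoUniformlyOn_iff.1 ((tendstoLocallyUniformlyOn_iff_forall_isCompact
    (isOpen_horizontalStrip a b)).1 hlim₁ K' hK'S hK'c) (ε / 2) (by positivity)
  have hu₂ := Metric.tendstoUniformlyOn_iff.1 ((tendstoLocallyUniformlyOn_iff_forall_isCompact
    (isOpen_horizontalStrip a b)).1 hlim₂ K' hK'S hK'c) (ε / 2) (by positivity)
  obtain ⟨t, ⟨h1, h2⟩, -, z, hz, hεz⟩ := ((hu₁.and hu₂).and hs').exists
  have h1 := h1 z hz
  have h2 := h2 z hz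
  rw [hE (hK'S hz)] at h2
  rw [← dist_eq_norm] at hεz
  have := dist_triangle_left (W (z + (s t + t : ℝ))) (W (z + s t)) (W₁ z)
  linarith

/-- The admissible `t` in `exists_gap` do not depend on `s`. So closeness within `ε₀` on `K` at one
shift reproduces itself at every shift at distance at most `1`, and finitely many such steps reach
any real part. -/
theorem exists_gap_substrip (h : IsSeparableRoot a b n A d W) {K : Set ℂ} (hKc : IsCompact K)
    (hKS : K ⊆ horizontalStrip a b) {z₀ : ℂ} (hK : K ∈ 𝓝 z₀) :
    ∃ ε₀ > 0, ∀ a' b' : ℝ, IsSubstrip a' b' a b → ∀ ε > 0,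
      ∀ᶠ t : ℝ in bohrFilter, ∀ s : ℝ,
        (∀ z ∈ K, ‖W (z + (s + t : ℝ)) - W (z + s)‖ ≤ ε₀) →
        ∀ z ∈ horizontalStrip (a' : EReal) (b' : EReal), ‖W (z + t) - W z‖ < ε := by
  obtain ⟨ε₀, hε₀, hgap⟩ := h.exists_gap hKc hKS hK
  refine ⟨ε₀, hε₀, fun a' b' hs ε hε => ?_⟩
  -- `K₁` serves to propagate closeness horizontally; `K₂`, a vertical cross-section, yields the
  -- final estimate at every height.
  let K₁ : Set ℂ := (fun q : ℂ × ℝ => q.1 + q.2) '' (K ×ˢ Set.Icc (-1) 1)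
  let K₂ : Set ℂ := (fun y : ℝ => (y : ℂ) * I) '' Set.Icc a' b'
  have hK₁ : IsCompact K₁ := (hKc.prod isCompact_Icc).image (by fun_prop)
  have hK₂ : IsCompact K₂ := isCompact_Icc.image (by fun_prop)
  have hK₁S : K₁ ⊆ horizontalStrip a b := by
    rintro _ ⟨q, hq, rfl⟩
    exact add_ofReal_mem_horizontalStrip (hKS hq.1) _
  have hK₂S : K₂ ⊆ horizontalStrip a b := by
    rintro _ ⟨y, hy, rfl⟩
    refine ⟨hs.1.trans_le ?_, lt_of_le_of_lt ?_ hs.2.2⟩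
    · simpa using hy.1
    · simpa using hy.2
  filter_upwards [hgap K₁ hK₁ hK₁S ε₀ hε₀, hgap K₂ hK₂ hK₂S ε hε] with t ht₁ ht₂ s hst z hz
  have hstep : ∀ r x : ℝ, |x| ≤ 1 → (∀ z ∈ K, ‖W (z + (r + t : ℝ)) - W (z + r)‖ ≤ ε₀) →
      ∀ z ∈ K, ‖W (z + (r + x + t : ℝ)) - W (z + (r + x : ℝ))‖ ≤ ε₀ := fun r x hx hr z hz => by
    have := ht₁ r hr (z + x) ⟨(z, x), ⟨hz, abs_le.1 hx⟩, rfl⟩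
    have e1 : z + (r + x + t : ℝ) = z + x + (r + t : ℝ) := by push_cast; ring
    have e2 : z + (r + x : ℝ) = z + x + r := by push_cast; ring
    rw [e1, e2]
    exact this.le
  have hmany : ∀ (m : ℕ) (x : ℝ), |x| ≤ 1 →
      ∀ z ∈ K, ‖W (z + (s + m * x + t : ℝ)) - W (z + (s + m * x : ℝ))‖ ≤ ε₀ := fun m x hx => by
    induction m with
    | zero => simpa using hst
    | succ m ih =>
      have := hstep _ x hx ih
      have e : s + ((m + 1 : ℕ) : ℝ) * x = s + m * x + x := by push_cast; ring
      rwa [e]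
  obtain ⟨m, hm⟩ := exists_nat_gt |z.re - s|
  have hm0 : (0 : ℝ) < m := (abs_nonneg _).trans_lt hm
  have hz' := hmany m ((z.re - s) / m) (by
    rw [abs_div, Nat.abs_cast, div_le_one hm0]; exact hm.le)
  rw [mul_div_cancel₀ _ hm0.ne', add_sub_cancel] at hz'
  have hfin := ht₂ z.re hz' ((z.im : ℝ) * I) ⟨z.im, by
    have := mem_horizontalStrip_coe.1 hz
    exact ⟨this.1.le, this.2.le⟩, rfl⟩
  have e1 : (z.im : ℂ) * I + (z.re + t : ℝ) = z + t := by
    apply Complex.ext <;> simp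
  have e2 : (z.im : ℂ) * I + z.re = z := by
    apply Complex.ext <;> simp
  rwa [e1, e2] at hfin

/-- In the limit, the shifts by `0, t, ..., n t` give `n + 1` holomorphic roots of the unshifted
equation of degree at most `n`; the pigeonhole principle makes two of them equal. -/
theorem eventually_exists_close (h : IsSeparableRoot a b n A d W) {K : Set ℂ} (hKc : IsCompact K)
    (hKS : K ⊆ horizontalStrip a b) {ε : ℝ} (hε : 0 < ε) :
    ∀ᶠ t : ℝ in bohrFilter, ∃ i k : ℕ, i < k ∧ k ≤ n ∧
      ∀ z ∈ K, ‖W (z + (k * t : ℝ)) - W (z + (i * t : ℝ))‖ ≤ ε := by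
  by_contra hcon
  obtain ⟨U, hU, hbad⟩ := (Filter.not_eventually.1 hcon).exists_ultrafilter_le
  push Not at hbad
  choose V hV hlim using fun i : ℕ =>
    h.bdd.exists_limit_translates h.differentiableOn U (fun t => i * t)
  have hroot : ∀ i, ∀ z ∈ horizontalStrip a b,
      ∑ j ∈ Finset.range (n + 1), A j z * V i z ^ j = 0 := fun i z hz => by
    refine h.root_of_tendsto hz (fun j => ?_) ((hlim i).tendsto_at hz)
    have := (h.coeff j).tendsto_translate (s := fun _ => 0)
      ((tendsto_nat_mul_bohrFilter i).mono_left hU) hz (c := A j z) (by simp)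
    simpa using this
  obtain ⟨j₀, hj₀, z₁, hz₁, hA⟩ := h.coeff_ne_zero
  have hSnhds := (isOpen_horizontalStrip a b).mem_nhds hz₁
  have hpair : ∀ᶠ z in 𝓝 z₁, ∃ q ∈ (Finset.range (n + 1) ×ˢ Finset.range (n + 1)).filter
      (fun q : ℕ × ℕ => q.1 < q.2), V q.1 z = V q.2 z := by
    filter_upwards [((h.coeff j₀).differentiableOn.continuousOn.continuousAt hSnhds).eventually_ne hA,
      hSnhds] with z hz hzS
    obtain ⟨i, k, hik, hk, he⟩ := exists_eq_of_roots hj₀ (c := fun j => A j z) (v := fun i => V i z)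
      hz fun i _ => hroot i z hzS
    exact ⟨(i, k), by simp only [Finset.mem_filter, Finset.mem_product, Finset.mem_range]; omega, he⟩
  -- The coinciding pair may vary with `z`. There are finitely many pairs, so one coincides at
  -- points accumulating at `z₁`, and the identity theorem applies to it.
  obtain ⟨q, hq, hfreq⟩ : ∃ q ∈ (Finset.range (n + 1) ×ˢ Finset.range (n + 1)).filter
      (fun q : ℕ × ℕ => q.1 < q.2), ∃ᶠ z in 𝓝[≠] z₁, V q.1 z = V q.2 z := by
    by_contra! hno
    have hall := (Filter.eventually_all_finset _).2 hno
    obtain ⟨z, ⟨q, hq, he⟩, hne⟩ := ((hpair.filter_mono nhdsWithin_le_nhds).and hall).exists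
    exact hne q hq he
  have hE := ((hV q.1).analyticOnNhd (isOpen_horizontalStrip a b)).eqOn_of_preconnected_of_frequently_eq
    ((hV q.2).analyticOnNhd (isOpen_horizontalStrip a b)) (convex_horizontalStrip a b).isPreconnected
    hz₁ hfreq
  simp only [Finset.mem_filter, Finset.mem_product, Finset.mem_range] at hq
  have hu := fun i => Metric.tendstoUniformlyOn_iff.1
    ((tendstoLocallyUniformlyOn_iff_forall_isCompact (isOpen_horizontalStrip a b)).1 (hlim i)
      K hKS hKc) (ε / 2) (by positivity)
  obtain ⟨t, ⟨h1, h2⟩, ht⟩ := (((hu q.1).and (hu q.2)).and hbad).exists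
  obtain ⟨z, hz, hεz⟩ := ht q.1 q.2 hq.2 (by omega)
  have h1 := h1 z hz
  have h2 := h2 z hz
  rw [hE (hKS hz)] at h1
  rw [← dist_eq_norm] at hεz
  have := dist_triangle_left (W (z + (q.2 * t : ℝ))) (W (z + (q.1 * t : ℝ))) (V q.2 z)
  linarith

theorem norm_translate_nat_mul_le {S : Set ℂ} {f : ℂ → ℂ} {t ε : ℝ}
    (hS : ∀ z ∈ S, ∀ x : ℝ, z + x ∈ S) (h : ∀ z ∈ S, ‖f (z + t) - f z‖ ≤ ε) (m : ℕ) :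
    ∀ z ∈ S, ‖f (z + (m * t : ℝ)) - f z‖ ≤ m * ε := by
  induction m with
  | zero => intro z _; simp
  | succ m ih =>
    intro z hz
    have h1 := h _ (hS z hz (m * t))
    have e : z + (((m + 1 : ℕ) : ℝ) * t : ℝ) = z + (m * t : ℝ) + t := by push_cast; ring
    rw [e]
    calc _ ≤ _ := norm_sub_le_norm_sub_add_norm_sub _ (f (z + (m * t : ℝ))) _
      _ ≤ ε + m * ε := add_le_add h1 (ih z hz)
      _ = _ := by push_cast; ring

theorem isBohrAP (h : IsSeparableRoot a b n A d W) : IsBohrAP a b W where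
  differentiableOn := h.differentiableOn
  bdd := h.bdd
  unif := fun a' b' hs => by
    obtain ⟨z₀, hz₀, -⟩ := h.minorant_ne_zero
    obtain ⟨K, ⟨hK, hKc⟩, hKS⟩ :=
      (compact_basis_nhds z₀).mem_iff.1 ((isOpen_horizontalStrip a b).mem_nhds hz₀)
    obtain ⟨ε₀, hε₀, hgap⟩ := h.exists_gap_substrip hKc hKS hK
    have hmain : ∀ ε > 0, ∀ᶠ t : ℝ in bohrFilter,
        ∀ z ∈ horizontalStrip (a' : EReal) (b' : EReal),
          ‖W (z + (n.factorial * t : ℝ)) - W z‖ ≤ ε := fun ε hε => by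
      have hn : (0 : ℝ) < n.factorial := by exact_mod_cast n.factorial_pos
      have hall := (Filter.eventually_all_finset (Finset.range (n + 1))).2 fun k _ =>
        (tendsto_nat_mul_bohrFilter k).eventually (hgap a' b' hs (ε / n.factorial) (by positivity))
      filter_upwards [hall, h.eventually_exists_close hKc hKS hε₀] with t ht hclose
      obtain ⟨i, k, hik, hkn, hc⟩ := hclose
      have hk0 : 0 < k - i := by omega
      have hs1 := ht (k - i) (Finset.mem_range.2 (by omega)) (i * t) (by
        have e : (i * t + ((k - i : ℕ) : ℝ) * t : ℝ) = k * t := by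
          rw [Nat.cast_sub hik.le]; ring
        rw [e]; exact hc)
      -- Passing to `n! t` removes the dependence of `k - i` on `t`; the error grows by `m ≤ n!`,
      -- which the tolerance `ε / n!` absorbs.
      obtain ⟨m, hm⟩ := Nat.dvd_factorial hk0 (show k - i ≤ n by omega)
      have hs2 := norm_translate_nat_mul_le (fun z hz x => add_ofReal_mem_horizontalStrip hz x)
        (fun z hz => (hs1 z hz).le) m
      intro z hz
      have e : (n.factorial * t : ℝ) = m * (((k - i : ℕ) : ℝ) * t) := by
        rw [hm]; push_cast; ring
      rw [e]
      refine (hs2 z hz).trans ?_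
      have hmn : (m : ℝ) ≤ n.factorial := by
        exact_mod_cast Nat.le_of_dvd n.factorial_pos ⟨k - i, by rw [hm]; ring⟩
      rw [mul_div_assoc', div_le_iff₀ hn, mul_comm]
      gcongr
    rw [Metric.tendstoUniformlyOn_iff]
    intro ε hε
    have hn : (n.factorial : ℝ) ≠ 0 := by exact_mod_cast n.factorial_ne_zero
    filter_upwards [(tendsto_div_bohrFilter n.factorial).eventually (hmain (ε / 2) (by positivity))]
      with t ht z hz
    have := ht z hz
    rw [mul_div_cancel₀ _ hn, ← dist_eq_norm, dist_comm] at this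
    linarith

end IsSeparableRoot

/-! ### Algebraic functions over the ring of almost periodic functions -/

/-- The ring of holomorphic functions on a strip that are bounded on substrips. -/
def bddHolomorphic (a b : EReal) : Subring (horizontalStrip a b → ℂ) where
  carrier := {f | ∃ g, DifferentiableOn ℂ g (horizontalStrip a b) ∧ BddOnSubstrips a b g ∧
    ∀ z : horizontalStrip a b, f z = g z}
  mul_mem' := by
    rintro _ _ ⟨f, hf, hf', h⟩ ⟨g, hg, hg', h'⟩
    exact ⟨_, hf.mul hg, hf'.mul hg', fun z => by simp [h, h']⟩
  one_mem' := ⟨fun _ => 1, differentiableOn_const 1, .const 1, fun z => rfl⟩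
  add_mem' := by
    rintro _ _ ⟨f, hf, hf', h⟩ ⟨g, hg, hg', h'⟩
    exact ⟨_, hf.add hg, hf'.add hg', fun z => by simp [h, h']⟩
  zero_mem' := ⟨fun _ => 0, differentiableOn_const 0, .const 0, fun z => rfl⟩
  neg_mem' := by
    rintro _ ⟨f, hf, hf', h⟩
    exact ⟨_, hf.const_mul (-1), (BddOnSubstrips.const (-1)).mul hf', fun z => by simp [h]⟩

/-- The ring of almost periodic functions on a strip. -/
def bohrAPRing (a b : EReal) : Subring (bddHolomorphic a b) where
  carrier := {f | ∃ g, IsBohrAP a b g ∧ ∀ z : horizontalStrip a b, f.1 z = g z}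
  mul_mem' := by
    rintro _ _ ⟨f, hf, h⟩ ⟨g, hg, h'⟩
    exact ⟨_, hf.mul hg, fun z => by simp [h, h']⟩
  one_mem' := ⟨fun _ => 1, .const 1, fun z => rfl⟩
  add_mem' := by
    rintro _ _ ⟨f, hf, h⟩ ⟨g, hg, h'⟩
    exact ⟨_, hf.add hg, fun z => by simp [h, h']⟩
  zero_mem' := ⟨fun _ => 0, .const 0, fun z => rfl⟩
  neg_mem' := by
    rintro _ ⟨f, hf, h⟩
    exact ⟨_, hf.neg, fun z => by simp [h]⟩

section

variable {a b : EReal}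

/-- Evaluation at a point of the strip. -/
def bddHolomorphicEval (z : horizontalStrip a b) : bddHolomorphic a b →+* ℂ :=
  (Pi.evalRingHom (fun _ => ℂ) z).comp (bddHolomorphic a b).subtype

theorem bddHolomorphicEval_apply (z : horizontalStrip a b) (f : bddHolomorphic a b) :
    bddHolomorphicEval z f = f.1 z := rfl

instance : NoZeroDivisors (bddHolomorphic a b) where
  eq_zero_or_eq_zero_of_mul_eq_zero := by
    rintro ⟨f, f', hf, _, hff'⟩ ⟨g, g', hg, _, hgg'⟩ h
    by_contra! hne
    have hf0 : ∃ z : horizontalStrip a b, f z ≠ 0 := by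
      by_contra! h0
      exact hne.1 (Subtype.ext (funext h0))
    obtain ⟨z, hz⟩ := hf0
    refine hne.2 (Subtype.ext (funext fun w => ?_))
    have hSnhds := (isOpen_horizontalStrip a b).mem_nhds z.2
    have h0 : g' =ᶠ[𝓝 (z : ℂ)] fun _ => 0 := by
      filter_upwards [(hf.continuousOn.continuousAt hSnhds).eventually_ne
        (show f' z ≠ 0 from hff' z ▸ hz), hSnhds]
        with v hv hvS
      have := congrFun (congrArg Subtype.val h) ⟨v, hvS⟩
      have : f ⟨v, hvS⟩ * g ⟨v, hvS⟩ = 0 := this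
      rw [hff', hgg'] at this
      exact (mul_eq_zero.1 this).resolve_left hv
    exact (hgg' w).trans (eqOn_horizontalStrip hg (differentiableOn_const 0) z.2 h0 w.2)

/-- Least degree plays the role of separability, and algebraicity of the derivative value provides
the minorant required by `IsSeparableRoot`. -/
theorem isBohrAP_of_isAlgebraic (hne : (horizontalStrip a b).Nonempty) {W : ℂ → ℂ}
    {f : bddHolomorphic a b} (hfW : ∀ z : horizontalStrip a b, f.1 z = W z)
    (hW : DifferentiableOn ℂ W (horizontalStrip a b)) (hWb : BddOnSubstrips a b W)
    (halg : IsAlgebraic (bohrAPRing a b) f) : IsBohrAP a b W := by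
  obtain ⟨z₀, hz₀⟩ := hne
  have hcz : CharZero (bddHolomorphic a b) := (bddHolomorphicEval ⟨z₀, hz₀⟩).charZero
  have hdom : IsDomain (bddHolomorphic a b) := NoZeroDivisors.to_isDomain _
  have hczR : CharZero (bohrAPRing a b) := (bohrAPRing a b).subtype.charZero
  obtain ⟨p, ⟨hp0, hp⟩, hmin⟩ := WellFounded.has_min
    (measure (fun p : Polynomial (bohrAPRing a b) => p.natDegree)).wf
    {p | p ≠ 0 ∧ Polynomial.aeval f p = 0} halg
  have hder : Polynomial.aeval f p.derivative ≠ 0 := by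
    have hdeg : p.natDegree ≠ 0 := by
      intro h
      obtain ⟨c, rfl⟩ := Polynomial.natDegree_eq_zero.1 h
      rw [Polynomial.aeval_C] at hp
      refine hp0 ?_
      rw [show c = 0 from Subtype.ext hp, map_zero]
    intro h
    refine hmin p.derivative ⟨fun h0 => ?_, h⟩ (Polynomial.natDegree_derivative_lt hdeg)
    exact hdeg (Polynomial.derivative_eq_zero.1 h0)
  have halg' : IsAlgebraic (bohrAPRing a b) (Polynomial.aeval f p.derivative) :=
    Algebra.isAlgebraic_adjoin_singleton_iff.2 ⟨p, hp0, hp⟩ _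
      (Polynomial.aeval_mem_adjoin_singleton _ _)
  have hmap : ∀ c : bohrAPRing a b,
      algebraMap (bohrAPRing a b) (bddHolomorphic a b) c = c.1 := fun _ => rfl
  -- The cofactor `T` lies in `bddHolomorphic`, so it is bounded on substrips; this turns
  -- divisibility into a lower bound for the derivative.
  obtain ⟨r, hr0, T, hT⟩ := halg'.exists_nonzero_dvd (mem_nonZeroDivisors_of_ne_zero hder)
  obtain ⟨d, hd, hrd⟩ := r.2
  obtain ⟨τ, -, hτb, hτ⟩ := T.2
  choose A hA hpA using fun j => (p.coeff j).2
  have hroot : ∀ z : horizontalStrip a b,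
      ∑ j ∈ Finset.range (p.natDegree + 1), A j z * W z ^ j = 0 := fun z => by
    have := congrArg (bddHolomorphicEval z) hp
    rw [Polynomial.aeval_eq_sum_range] at this
    simpa only [map_sum, Algebra.smul_def, map_mul, map_pow, map_zero,
      bddHolomorphicEval_apply, hfW, hmap, hpA] using this
  have hderiv : ∀ z : horizontalStrip a b, (Polynomial.aeval f p.derivative).1 z
      = ∑ j ∈ Finset.range (p.natDegree + 1), A j z * (j * W z ^ (j - 1)) := fun z => by
    have e : Polynomial.aeval f p.derivative
        = ∑ j ∈ Finset.range (p.natDegree + 1), (p.coeff j).1 * (j * f ^ (j - 1)) := by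
      conv_lhs => rw [p.as_sum_range_C_mul_X_pow]
      simp only [map_sum, Polynomial.derivative_C_mul_X_pow]
      refine Finset.sum_congr rfl fun j _ => ?_
      simp [mul_assoc, hmap]
    rw [e, ← bddHolomorphicEval_apply]
    simp [bddHolomorphicEval_apply, hfW, hpA]
  refine IsSeparableRoot.isBohrAP (n := p.natDegree) (A := A) (d := d)
    ⟨hA, hW, hWb, fun z hz => hroot ⟨z, hz⟩, ⟨p.natDegree, le_rfl, ?_⟩, hd, ?_, fun a' b' hs => ?_⟩
  · by_contra! h0
    refine hp0 (Polynomial.leadingCoeff_eq_zero.1 (Subtype.ext (Subtype.ext (funext fun z => ?_))))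
    exact (hpA _ z).trans (h0 z z.2)
  · by_contra! h0
    refine hr0 (Subtype.ext (Subtype.ext (funext fun z => ?_)))
    exact (hrd z).trans (h0 z z.2)
  · obtain ⟨C, hC0, hC⟩ := hτb.exists_pos hs
    refine ⟨C, hC0, fun z hz => ?_⟩
    have h1 := congrArg (bddHolomorphicEval ⟨z, hs.subset hz⟩) hT
    rw [map_mul, bddHolomorphicEval_apply, bddHolomorphicEval_apply, bddHolomorphicEval_apply,
      hderiv, hτ] at h1
    rw [← hrd ⟨z, hs.subset hz⟩]
    have h2 : r.1.1 ⟨z, hs.subset hz⟩ = _ := h1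
    rw [h2, norm_mul, mul_comm]
    gcongr
    exact hC z hz

/-- A holomorphic function on a strip that is bounded on substrips and satisfies an algebraic
equation with almost periodic coefficients is almost periodic. -/
theorem isBohrAP_of_root {n : ℕ} {A : ℕ → ℂ → ℂ} {W : ℂ → ℂ} (hA : ∀ j, IsBohrAP a b (A j))
    (hW : DifferentiableOn ℂ W (horizontalStrip a b)) (hWb : BddOnSubstrips a b W)
    (hroot : ∀ z ∈ horizontalStrip a b, ∑ j ∈ Finset.range (n + 1), A j z * W z ^ j = 0)
    (hne : ∃ j ≤ n, ∃ z ∈ horizontalStrip a b, A j z ≠ 0) : IsBohrAP a b W := by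
  let f : bddHolomorphic a b := ⟨fun z => W z, W, hW, hWb, fun _ => rfl⟩
  let A' : ℕ → bohrAPRing a b := fun j => ⟨⟨fun z => A j z, A j, (hA j).differentiableOn,
    (hA j).bdd, fun _ => rfl⟩, A j, hA j, fun _ => rfl⟩
  obtain ⟨j₀, hj₀, z₀, hz₀, hAz⟩ := hne
  refine isBohrAP_of_isAlgebraic ⟨z₀, hz₀⟩ (f := f) (fun _ => rfl) hW hWb
    ⟨∑ j ∈ Finset.range (n + 1), Polynomial.C (A' j) * Polynomial.X ^ j, fun h0 => ?_, ?_⟩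
  · have := congrArg (fun p => p.coeff j₀) h0
    simp [Polynomial.coeff_C_mul, Polynomial.coeff_X_pow, Polynomial.finsetSum_coeff,
      hj₀] at this
    have h1 := congrFun (congrArg (fun x : bohrAPRing a b => x.1.1) this) ⟨z₀, hz₀⟩
    exact hAz h1
  · refine Subtype.ext (funext fun z => ?_)
    rw [← bddHolomorphicEval_apply]
    simp only [map_sum, map_mul, map_pow, Polynomial.aeval_C, Polynomial.aeval_X]
    exact hroot z z.2

end

/-! ### Poles -/

theorem norm_le_of_forall_sphere_norm_le {f : ℂ → ℂ} {c : ℂ} {r D : ℝ} (hr : 0 < r)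
    (hf : ∀ z ∈ Metric.closedBall c r, DifferentiableAt ℂ f z)
    (hD : ∀ z ∈ Metric.sphere c r, ‖f z‖ ≤ D) : ∀ z ∈ Metric.closedBall c r, ‖f z‖ ≤ D := by
  intro z hz
  refine Complex.norm_le_of_forall_mem_frontier_norm_le (Metric.isBounded_ball (x := c) (r := r))
    ?_ ?_ ?_
  · refine DifferentiableOn.diffContOnCl fun z hz => ?_
    rw [closure_ball c hr.ne'] at hz
    exact (hf z hz).differentiableWithinAt
  · rwa [frontier_ball c hr.ne']
  · rwa [closure_ball c hr.ne']

theorem exists_pos_le_norm_of_sphere {f : ℂ → ℂ} {c : ℂ} {r : ℝ}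
    (hf : ContinuousOn f (Metric.sphere c r)) (hne : ∀ z ∈ Metric.sphere c r, f z ≠ 0) :
    ∃ κ > 0, ∀ z ∈ Metric.sphere c r, κ ≤ ‖f z‖ := by
  rcases (Metric.sphere c r).eq_empty_or_nonempty with he | hn
  · exact ⟨1, one_pos, by simp [he]⟩
  · obtain ⟨z, hz, hmin⟩ := (isCompact_sphere c r).exists_isMinOn hn hf.norm
    exact ⟨‖f z‖, norm_pos_iff.2 (hne z hz), fun w hw => hmin hw⟩

theorem eventually_ne_zero_of_differentiableOn {a b : EReal} {g : ℂ → ℂ}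
    (hg : DifferentiableOn ℂ g (horizontalStrip a b))
    (hne : ∃ z ∈ horizontalStrip a b, g z ≠ 0) {z : ℂ} (hz : z ∈ horizontalStrip a b) :
    ∀ᶠ y in 𝓝[≠] z, g y ≠ 0 := by
  rcases (hg.analyticOnNhd (isOpen_horizontalStrip a b) z hz).eventually_eq_zero_or_eventually_ne_zero
    with h | h
  · obtain ⟨v, hv, hgv⟩ := hne
    exact absurd (eqOn_horizontalStrip hg (differentiableOn_const 0) hz h hv) hgv
  · exact h

/-- Small closed disc around a point contained in a neighbourhood, and in a punctured one. -/
theorem exists_closedBall_of_eventually {z : ℂ} {p q : ℂ → Prop} (hp : ∀ᶠ y in 𝓝 z, p y)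
    (hq : ∀ᶠ y in 𝓝[≠] z, q y) :
    ∃ r > 0, (∀ y ∈ Metric.closedBall z r, p y) ∧ ∀ y ∈ Metric.closedBall z r, y ≠ z → q y := by
  rw [eventually_nhdsWithin_iff] at hq
  obtain ⟨r, hr, h⟩ := Metric.nhds_basis_closedBall.eventually_iff.1 (hp.and hq)
  exact ⟨r, hr, fun y hy => (h hy).1, fun y hy => (h hy).2⟩

/-- A holomorphic quotient of almost periodic functions is bounded on substrips. -/
theorem bddOnSubstrips_of_mul_eq {a b : EReal} {g w W : ℂ → ℂ} (hg : IsBohrAP a b g)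
    (hgne : ∃ z ∈ horizontalStrip a b, g z ≠ 0) (hW : BddOnSubstrips a b W)
    (hw : DifferentiableOn ℂ w (horizontalStrip a b))
    (hmul : ∀ z ∈ horizontalStrip a b, W z = g z * w z) : BddOnSubstrips a b w := by
  intro a' b' hs
  by_contra! hcon
  choose z hz hzn using fun n : ℕ => hcon n
  let U := hyperfilter ℕ
  have hU : (U : Filter ℕ) ≤ atTop := Nat.cofinite_eq_atTop ▸ hyperfilter_le_cofinite
  obtain ⟨g', hg', hlim⟩ := hg.exists_limit_translates U (fun n => (z n).re)
  obtain ⟨y, hy, hlimy⟩ := (isCompact_Icc (a := a') (b := b')).ultrafilter_le_nhds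
    (U.map fun n => (z n).im) (by
      refine le_principal_iff.2 (Filter.mem_map.2 (Eventually.of_forall fun n => ?_))
      have := mem_horizontalStrip_coe.1 (hz n)
      exact ⟨this.1.le, this.2.le⟩)
  have hlimy : Tendsto (fun n => (z n).im) U (𝓝 y) := hlimy
  set ζ : ℂ := ⟨0, y⟩ with hζ
  have hζS : ζ ∈ horizontalStrip a b :=
    ⟨hs.1.trans_le (by exact_mod_cast hy.1), lt_of_le_of_lt (by exact_mod_cast hy.2) hs.2.2⟩
  have hg'ne : ∃ z ∈ horizontalStrip a b, g' z ≠ 0 := by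
    by_contra! h0
    obtain ⟨v, hv, hgv⟩ := hgne
    exact hgv (eq_zero_of_limit_translates hg' hlim hζS
      (eventually_of_mem ((isOpen_horizontalStrip a b).mem_nhds hζS) h0) v hv)
  obtain ⟨r, hr, hrS, hrne⟩ := exists_closedBall_of_eventually
    ((isOpen_horizontalStrip a b).mem_nhds hζS) (eventually_ne_zero_of_differentiableOn hg' hg'ne hζS)
  have hrS : Metric.closedBall ζ r ⊆ horizontalStrip a b := hrS
  obtain ⟨κ, hκ, hκle⟩ := exists_pos_le_norm_of_sphere
    (hg'.continuousOn.mono (Metric.sphere_subset_closedBall.trans hrS)) fun v hv =>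
      hrne v (Metric.sphere_subset_closedBall hv) (Metric.ne_of_mem_sphere hv hr.ne')
  obtain ⟨p, q, hpq, hsub⟩ := exists_substrip_of_isCompact (isCompact_closedBall ζ r)
    ⟨ζ, Metric.mem_closedBall_self hr.le⟩ hrS
  obtain ⟨M, hM0, hM⟩ := hW.exists_pos hpq
  have hball : ∀ᶠ n in (U : Filter ℕ), (⟨0, (z n).im⟩ : ℂ) ∈ Metric.closedBall ζ r := by
    filter_upwards [Metric.tendsto_nhds.1 hlimy r hr] with n hn
    rw [Metric.mem_closedBall, Complex.dist_of_re_eq (by rfl)]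
    exact hn.le
  obtain ⟨n, ⟨h1, h2⟩, h3⟩ := (((Metric.tendstoUniformlyOn_iff.1 (hlim p q hpq) (κ / 2)
    (by positivity)).and hball).and (hU (eventually_gt_atTop ⌈M / (κ / 2)⌉₊))).exists
  have hbd : ∀ v ∈ Metric.closedBall ζ r, ‖w (v + (z n).re)‖ ≤ M / (κ / 2) := by
    refine norm_le_of_forall_sphere_norm_le hr (fun v hv => ?_) fun v hv => ?_
    · exact (differentiableOn_translate hw _).differentiableAt
        ((isOpen_horizontalStrip a b).mem_nhds (hrS hv))
    · have hvb := Metric.sphere_subset_closedBall hv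
      have hv1 := h1 v (hsub hvb)
      rw [dist_eq_norm] at hv1
      have hv2 := hκle v hv
      have hv3 : κ / 2 ≤ ‖g (v + (z n).re)‖ := by
        linarith [norm_sub_norm_le (g' v) (g (v + (z n).re))]
      have hv4 := hM _ (add_ofReal_mem_horizontalStrip (hsub hvb) (z n).re)
      rw [hmul _ (add_ofReal_mem_horizontalStrip (hrS hvb) _), norm_mul] at hv4
      rw [le_div_iff₀ (by positivity), mul_comm]
      exact (mul_le_mul_of_nonneg_right hv3 (norm_nonneg _)).trans hv4
  have := hbd _ h2
  have e : (⟨0, (z n).im⟩ : ℂ) + (z n).re = z n := by apply Complex.ext <;> simp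
  rw [e] at this
  have h4 := (hzn n).trans_le this
  exact absurd (h4.trans_le (Nat.le_ceil _)) (not_lt.2 (by exact_mod_cast h3.le))

section Poles

variable {a b : EReal} {g w W : ℂ → ℂ}

theorem IsMeromorphicFunctionOn.eventually_not_isPoleAt
    (hw : IsMeromorphicFunctionOn w (horizontalStrip a b)) {z : ℂ} (hz : z ∈ horizontalStrip a b) :
    ∀ᶠ y in 𝓝[≠] z, y ∈ horizontalStrip a b ∧ ¬ IsPoleAt w y := by
  filter_upwards [(hw.1 z hz).eventually_analyticAt,
    mem_nhdsWithin_of_mem_nhds ((isOpen_horizontalStrip a b).mem_nhds hz)] with y hy hyS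
  exact ⟨hyS, not_lt.2 hy.meromorphicOrderAt_nonneg⟩

/-- Finiteness is needed because `Set.ncard` is `0` on infinite sets, so `poleCount` would not bound
the number of poles from below. -/
theorem IsMeromorphicFunctionOn.finite_poles
    (hw : IsMeromorphicFunctionOn w (horizontalStrip a b)) {a' b' : ℝ} (hs : IsSubstrip a' b' a b)
    (t : ℝ) : {z : ℂ | z ∈ horizontalStrip (a' : EReal) (b' : EReal) ∧ |z.re| < t ∧
      IsPoleAt w z}.Finite := by
  by_contra hinf
  obtain ⟨z, hzK, hz⟩ := Set.Infinite.exists_accPt_of_subset_isCompact hinf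
    ((isCompact_Icc (a := -t) (b := t)).reProdIm (isCompact_Icc (a := a') (b := b')))
    fun z hz => by
      have h1 := mem_horizontalStrip_coe.1 hz.1
      have h2 := abs_lt.1 hz.2.1
      exact ⟨⟨h2.1.le, h2.2.le⟩, h1.1.le, h1.2.le⟩
  have hzS : z ∈ horizontalStrip a b :=
    ⟨hs.1.trans_le (by exact_mod_cast hzK.2.1), lt_of_le_of_lt (by exact_mod_cast hzK.2.2) hs.2.2⟩
  obtain ⟨y, hy, hy'⟩ := ((accPt_iff_frequently_nhdsNE.1 hz).and_eventually
    (hw.eventually_not_isPoleAt hzS)).exists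
  exact hy'.2 hy.2.2

/-- Near the translates of a pole of a quotient of almost periodic functions by numbers that are
small in the Bohr topology there are poles. -/
theorem eventually_exists_isPoleAt (hg : IsBohrAP a b g)
    (hgne : ∃ z ∈ horizontalStrip a b, g z ≠ 0) (hW : IsBohrAP a b W)
    (hw : IsMeromorphicFunctionOn w (horizontalStrip a b))
    (hmul : ∀ z ∈ horizontalStrip a b, ¬ IsPoleAt w z → W z = g z * w z) {z₀ : ℂ}
    (hz₀ : z₀ ∈ horizontalStrip a b) (hpole : IsPoleAt w z₀) :
    ∃ r, 0 < r ∧ Metric.closedBall z₀ r ⊆ horizontalStrip a b ∧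
      ∀ᶠ t : ℝ in bohrFilter, ∃ p ∈ Metric.closedBall z₀ r, IsPoleAt w (p + t) := by
  obtain ⟨r, hr, hrS, hrq⟩ := exists_closedBall_of_eventually
    ((isOpen_horizontalStrip a b).mem_nhds hz₀)
    ((eventually_ne_zero_of_differentiableOn hg.differentiableOn hgne hz₀).and
      (hw.eventually_not_isPoleAt hz₀))
  have hrS : Metric.closedBall z₀ r ⊆ horizontalStrip a b := hrS
  refine ⟨r, hr, hrS, ?_⟩
  by_contra hcon
  obtain ⟨U, hU, hno⟩ := (Filter.not_eventually.1 hcon).exists_ultrafilter_le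
  push Not at hno
  obtain ⟨κ, hκ, hκle⟩ := exists_pos_le_norm_of_sphere
    (hg.differentiableOn.continuousOn.mono (Metric.sphere_subset_closedBall.trans hrS)) fun v hv =>
      (hrq v (Metric.sphere_subset_closedBall hv) (Metric.ne_of_mem_sphere hv hr.ne')).1
  obtain ⟨p, q, hpq, hsub⟩ := exists_substrip_of_isCompact (isCompact_closedBall z₀ r)
    ⟨z₀, Metric.mem_closedBall_self hr.le⟩ hrS
  obtain ⟨M, hM0, hM⟩ := hW.bdd.exists_pos hpq
  -- Without poles in the translated disc, the maximum principle bounds `w` there. The resulting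
  -- inequality between `W` and `g` survives the limit in `t`, which bounds `w` near its supposed
  -- pole.
  have hev : ∀ᶠ t : ℝ in (U : Filter ℝ), ∀ v ∈ Metric.closedBall z₀ r,
      ‖W (v + t)‖ ≤ M / (κ / 2) * ‖g (v + t)‖ := by
    filter_upwards [hU (Metric.tendstoUniformlyOn_iff.1 (hg.unif p q hpq) (κ / 2) (by positivity)),
      hno] with t ht hnt
    have hbd : ∀ v ∈ Metric.closedBall z₀ r, ‖w (v + t)‖ ≤ M / (κ / 2) := by
      refine norm_le_of_forall_sphere_norm_le hr (fun v hv => ?_) fun v hv => ?_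
      · have hd := (hw.2 _ (add_ofReal_mem_horizontalStrip (hrS hv) t) (hnt v hv)).differentiableAt
        exact hd.comp v (by fun_prop)
      · have hvb := Metric.sphere_subset_closedBall hv
        have hv1 := ht v (hsub hvb)
        rw [dist_eq_norm] at hv1
        have hv2 := hκle v hv
        have hv3 : κ / 2 ≤ ‖g (v + t)‖ := by
          linarith [norm_sub_norm_le (g v) (g (v + t))]
        have hv4 := hM _ (add_ofReal_mem_horizontalStrip (hsub hvb) t)
        rw [hmul _ (add_ofReal_mem_horizontalStrip (hrS hvb) _) (hnt v hvb), norm_mul] at hv4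
        rw [le_div_iff₀ (by positivity), mul_comm]
        exact (mul_le_mul_of_nonneg_right hv3 (norm_nonneg _)).trans hv4
    intro v hv
    rw [hmul _ (add_ofReal_mem_horizontalStrip (hrS hv) _) (hnt v hv), norm_mul, mul_comm]
    gcongr
    exact hbd v hv
  have hle : ∀ v ∈ Metric.closedBall z₀ r, ‖W v‖ ≤ M / (κ / 2) * ‖g v‖ := fun v hv =>
    le_of_tendsto_of_tendsto (((hW.unif p q hpq).tendsto_at (hsub hv)).mono_left hU).norm
      ((((hg.unif p q hpq).tendsto_at (hsub hv)).mono_left hU).norm.const_mul _)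
      (hev.mono fun t ht => ht v hv)
  have hlt : ∀ᶠ v in 𝓝[≠] z₀, M / (κ / 2) < ‖w v‖ :=
    (tendsto_norm_atTop_iff_cobounded.2 (tendsto_cobounded_of_meromorphicOrderAt_neg hpole)).eventually
      (eventually_gt_atTop _)
  obtain ⟨v, ⟨hv1, hv2⟩, hv3⟩ := ((hlt.and (mem_nhdsWithin_of_mem_nhds
    (Metric.closedBall_mem_nhds z₀ hr))).and self_mem_nhdsWithin).exists
  obtain ⟨hgv, hvS, hvp⟩ := hrq v hv2 hv3
  have h1 := hle v hv2
  rw [hmul v hvS hvp, norm_mul, mul_comm] at h1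
  exact absurd hv1 (not_lt.2 (le_of_mul_le_mul_right h1 (norm_pos_iff.2 hgv)))

/-- A quotient of almost periodic functions whose poles have density zero has no poles. -/
theorem not_isPoleAt_of_mul_eq (hg : IsBohrAP a b g)
    (hgne : ∃ z ∈ horizontalStrip a b, g z ≠ 0) (hW : IsBohrAP a b W)
    (hw : IsMeromorphicFunctionOn w (horizontalStrip a b))
    (hmul : ∀ z ∈ horizontalStrip a b, ¬ IsPoleAt w z → W z = g z * w z)
    (hpoles : ∀ a' b' : ℝ, IsSubstrip a' b' a b →
      (fun t : ℝ => (poleCount w a' b' t : ℝ)) =o[atTop] (fun t : ℝ => t)) :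
    ∀ z ∈ horizontalStrip a b, ¬ IsPoleAt w z := by
  intro z₀ hz₀ hpole
  obtain ⟨r, hr, hrS, hev⟩ := eventually_exists_isPoleAt hg hgne hW hw hmul hz₀ hpole
  obtain ⟨p, q, hpq, hsub⟩ := exists_substrip_of_isCompact (isCompact_closedBall z₀ r)
    ⟨z₀, Metric.mem_closedBall_self hr.le⟩ hrS
  obtain ⟨F, hF⟩ := exists_finset_translates hev
  set L : ℝ := r + ∑ s ∈ F, |s| with hL
  have hL0 : 0 < L := add_pos_of_pos_of_nonneg hr (Finset.sum_nonneg fun s _ => abs_nonneg s)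
  have hdense : ∀ x : ℝ, ∃ v, v ∈ horizontalStrip (p : EReal) (q : EReal) ∧ |v.re - x| ≤ L ∧
      IsPoleAt w v := fun x => by
    obtain ⟨s, hs, v, hv, hvp⟩ := hF (x - z₀.re)
    refine ⟨_, add_ofReal_mem_horizontalStrip (hsub hv) _, ?_, hvp⟩
    have h1 : |v.re - z₀.re| ≤ r := by
      rw [← Complex.sub_re]
      exact (Complex.abs_re_le_norm _).trans (by simpa [dist_eq_norm] using hv)
    have h2 : |s| ≤ ∑ s ∈ F, |s| := Finset.single_le_sum (f := fun s => |s|)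
      (fun s _ => abs_nonneg s) hs
    have e : (v + ((x - z₀.re - s : ℝ) : ℂ)).re - x = (v.re - z₀.re) - s := by
      simp only [add_re, ofReal_re]; ring
    rw [e]
    exact (abs_sub _ _).trans (add_le_add h1 h2)
  choose v hvS hvx hvp using hdense
  -- Windows of radius `L` centred at multiples of `3 * L` are disjoint and each contains a pole, so
  -- the count up to `3 * L * N` is at least `N`; the `o(t)` bound below gives at most `N / 2`.
  have hcount : ∀ N : ℕ, (N : ℝ) ≤ poleCount w p q (3 * L * N) := fun N => by
    let f : Fin N → ℂ := fun i => v (3 * L * (i : ℕ))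
    have hinj : Function.Injective f := by
      intro i j hij
      by_contra hne
      have h1 := hvx (3 * L * (i : ℕ))
      have h2 := hvx (3 * L * (j : ℕ))
      have hij : v (3 * L * (i : ℕ)) = v (3 * L * (j : ℕ)) := hij
      rw [hij] at h1
      have h3 : |3 * L * (i : ℕ) - 3 * L * (j : ℕ)| ≤ 2 * L := by
        have := abs_sub_le (3 * L * (i : ℕ)) (v (3 * L * (j : ℕ))).re (3 * L * (j : ℕ))
        rw [abs_sub_comm (3 * L * (i : ℕ)) (v (3 * L * (j : ℕ))).re] at this
        linarith
      have h4 : (1 : ℝ) ≤ |((i : ℕ) : ℝ) - ((j : ℕ) : ℝ)| := by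
        have : (1 : ℤ) ≤ |((i : ℕ) : ℤ) - ((j : ℕ) : ℤ)| :=
          Int.one_le_abs (sub_ne_zero.2 fun h => hne (Fin.ext (by exact_mod_cast h)))
        exact_mod_cast this
      rw [← mul_sub, abs_mul, abs_of_pos (by positivity)] at h3
      nlinarith
    have hcard : N ≤ poleCount w p q (3 * L * N) := by
      have hsubset : Set.range f ⊆ {z : ℂ | z ∈ horizontalStrip (p : EReal) (q : EReal) ∧
          |z.re| < 3 * L * N ∧ IsPoleAt w z} := by
        rintro _ ⟨i, rfl⟩
        refine ⟨hvS _, ?_, hvp _⟩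
        have h1 := hvx (3 * L * (i : ℕ))
        have h2 : ((i : ℕ) : ℝ) + 1 ≤ N := by exact_mod_cast i.2
        have h3 : |(f i).re| ≤ |(f i).re - 3 * L * (i : ℕ)| + |3 * L * (i : ℕ)| := by
          simpa using abs_add_le ((f i).re - 3 * L * (i : ℕ)) (3 * L * (i : ℕ))
        rw [abs_of_nonneg (show (0 : ℝ) ≤ 3 * L * (i : ℕ) by positivity)] at h3
        have h4 : 3 * L * ((i : ℕ) + 1) ≤ 3 * L * N := by gcongr
        have h5 : |(f i).re - 3 * L * (i : ℕ)| ≤ L := h1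
        linarith
      have h1 := Set.ncard_le_ncard hsubset (hw.finite_poles hpq _)
      rwa [← Set.image_univ, Set.ncard_image_of_injective _ hinj, Set.ncard_univ, Nat.card_fin] at h1
    exact_mod_cast hcard
  have ho := (hpoles p q hpq).def (show 0 < 1 / (6 * L) by positivity)
  have htend : Tendsto (fun N : ℕ => 3 * L * (N : ℝ)) atTop atTop :=
    tendsto_natCast_atTop_atTop.const_mul_atTop (by positivity)
  obtain ⟨N, hN, hN0⟩ := ((htend.eventually ho).and (eventually_gt_atTop 0)).exists
  have hN0 : (0 : ℝ) < N := by exact_mod_cast hN0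
  rw [Real.norm_of_nonneg (Nat.cast_nonneg _), Real.norm_of_nonneg (by positivity)] at hN
  have := (hcount N).trans hN
  have e : 1 / (6 * L) * (3 * L * N) = N / 2 := by field_simp; norm_num
  rw [e] at this
  linarith

end Poles

/-! ### Clearing the leading coefficient -/

/-- Cauchy's bound: beyond this radius the leading term dominates all others. -/
theorem norm_le_of_monic_root {k : ℕ} {B : ℕ → ℂ} {v : ℂ}
    (h : v ^ k + ∑ j ∈ Finset.range k, B j * v ^ j = 0) :
    ‖v‖ ≤ 1 + ∑ j ∈ Finset.range k, ‖B j‖ := by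
  have hs : 0 ≤ ∑ j ∈ Finset.range k, ‖B j‖ := Finset.sum_nonneg fun j _ => norm_nonneg _
  by_contra! hcon
  have hv1 : 1 ≤ ‖v‖ := by linarith
  have hv0 : 0 < ‖v‖ := by linarith
  rcases k with - | k
  · simp at h
  have h1 : ‖v‖ ^ (k + 1) ≤ (∑ j ∈ Finset.range (k + 1), ‖B j‖) * ‖v‖ ^ k := by
    rw [← norm_pow, eq_neg_of_add_eq_zero_left h, norm_neg, Finset.sum_mul]
    refine norm_sum_le_of_le _ fun j hj => ?_
    rw [norm_mul, norm_pow]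
    exact mul_le_mul_of_nonneg_left (pow_le_pow_right₀ hv1 (Nat.lt_succ_iff.1 (Finset.mem_range.1 hj)))
      (norm_nonneg _)
  rw [pow_succ', mul_le_mul_iff_left₀ (by positivity)] at h1
  linarith

/-- The equation multiplied by the power `k - 1` of its leading coefficient is monic in `A k * w`.
-/
theorem monic_equation {k : ℕ} {A : ℕ → ℂ} {w : ℂ} (hk : k ≠ 0)
    (h : ∑ j ∈ Finset.range (k + 1), A j * w ^ j = 0) :
    (A k * w) ^ k + ∑ j ∈ Finset.range k, (A j * A k ^ (k - 1 - j)) * (A k * w) ^ j = 0 := by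
  have e : (A k * w) ^ k + ∑ j ∈ Finset.range k, (A j * A k ^ (k - 1 - j)) * (A k * w) ^ j
      = A k ^ (k - 1) * ∑ j ∈ Finset.range (k + 1), A j * w ^ j := by
    rw [Finset.sum_range_succ, mul_add, Finset.mul_sum, add_comm]
    congr 1
    · refine Finset.sum_congr rfl fun j hj => ?_
      have : k - 1 = (k - 1 - j) + j := by have := Finset.mem_range.1 hj; omega
      conv_rhs => rw [this]
      rw [pow_add, mul_pow]; ring
    · rw [mul_pow, ← mul_assoc, ← pow_succ, Nat.sub_add_cancel (Nat.one_le_iff_ne_zero.2 hk)]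
  rw [e, h, mul_zero]

/-- Being a root of a monic equation with bounded coefficients, `A k * w` is bounded off the poles,
so its singularities are removable. -/
theorem exists_isBohrAP_mul_eq {a b : EReal} {k : ℕ} {A : ℕ → ℂ → ℂ} {w : ℂ → ℂ}
    (hA : ∀ j, IsBohrAP a b (A j)) (hk : ∃ z ∈ horizontalStrip a b, A k z ≠ 0)
    (hw : IsMeromorphicFunctionOn w (horizontalStrip a b))
    (heq : ∀ z ∈ horizontalStrip a b, ¬ IsPoleAt w z →
      ∑ j ∈ Finset.range (k + 1), A j z * w z ^ j = 0) :
    ∃ W, IsBohrAP a b W ∧ ∀ z ∈ horizontalStrip a b, ¬ IsPoleAt w z → W z = A k z * w z := by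
  obtain ⟨z₁, hz₁, hA₁⟩ := hk
  have hcontA : ∀ j, ∀ z ∈ horizontalStrip a b, ContinuousAt (A j) z := fun j z hz =>
    (hA j).differentiableOn.continuousOn.continuousAt ((isOpen_horizontalStrip a b).mem_nhds hz)
  have hk0 : k ≠ 0 := by
    rintro rfl
    obtain ⟨y, ⟨hyS, hyp⟩, hy⟩ := ((hw.eventually_not_isPoleAt hz₁).and
      (((hcontA 0 z₁ hz₁).eventually_ne hA₁).filter_mono nhdsWithin_le_nhds)).exists
    exact hy (by simpa using heq y hyS hyp)
  let B : ℕ → ℂ → ℂ := fun j z => A j z * A k z ^ (k - 1 - j)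
  have hB : ∀ j, IsBohrAP a b (B j) := fun j => (hA j).mul ((hA k).pow _)
  have hmonic : ∀ z ∈ horizontalStrip a b, ¬ IsPoleAt w z →
      (A k z * w z) ^ k + ∑ j ∈ Finset.range k, B j z * (A k z * w z) ^ j = 0 :=
    fun z hz hp => monic_equation (A := fun j => A j z) hk0 (heq z hz hp)
  have hbdd : ∀ a' b' : ℝ, IsSubstrip a' b' a b → ∃ C,
      ∀ z ∈ horizontalStrip (a' : EReal) (b' : EReal), ¬ IsPoleAt w z → ‖A k z * w z‖ ≤ C := by
    intro a' b' hs
    choose D hD using fun j => (hB j).bdd a' b' hs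
    refine ⟨1 + ∑ j ∈ Finset.range k, D j, fun z hz hp => ?_⟩
    refine (norm_le_of_monic_root (hmonic z (hs.subset hz) hp)).trans ?_
    gcongr with j _
    exact hD j z hz
  let f : ℂ → ℂ := fun z => A k z * w z
  have hfm : MeromorphicOn f (horizontalStrip a b) := fun z hz =>
    ((hA k).differentiableOn.analyticAt ((isOpen_horizontalStrip a b).mem_nhds hz)).meromorphicAt.mul
      (hw.1 z hz)
  -- The normal form repairs the arbitrary values of `w` at its poles and leaves `f` unchanged where
  -- `w` is analytic.
  let W := toMeromorphicNFOn f (horizontalStrip a b)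
  have hWan : ∀ z ∈ horizontalStrip a b, AnalyticAt ℂ W z := fun z hz => by
    rw [← (meromorphicNFOn_toMeromorphicNFOn f _ hz).meromorphicOrderAt_nonneg_iff_analyticAt,
      meromorphicOrderAt_toMeromorphicNFOn hfm hz]
    by_contra! hneg
    obtain ⟨a', b', hs, hz'⟩ := exists_substrip_mem hz
    obtain ⟨C, hC⟩ := hbdd a' b' hs
    have h1 := (tendsto_norm_atTop_iff_cobounded.2
      (tendsto_cobounded_of_meromorphicOrderAt_neg hneg)).eventually (eventually_gt_atTop C)
    obtain ⟨y, ⟨hy1, hy2⟩, hy3⟩ := ((h1.and (hw.eventually_not_isPoleAt hz)).and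
      (mem_nhdsWithin_of_mem_nhds ((isOpen_horizontalStrip _ _).mem_nhds hz'))).exists
    exact absurd hy1 (not_lt.2 (hC y hy3 hy2.2))
  have hWf : ∀ z ∈ horizontalStrip a b, ¬ IsPoleAt w z → W z = A k z * w z := fun z hz hp => by
    have hfa : AnalyticAt ℂ f z :=
      ((hA k).differentiableOn.analyticAt ((isOpen_horizontalStrip a b).mem_nhds hz)).mul
        (hw.2 z hz hp)
    simp only [W]
    rw [toMeromorphicNFOn_eq_toMeromorphicNFAt hfm hz,
      toMeromorphicNFAt_eq_self.2 hfa.meromorphicNFAt]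
  have hWd : DifferentiableOn ℂ W (horizontalStrip a b) := fun z hz =>
    (hWan z hz).differentiableAt.differentiableWithinAt
  have hWb : BddOnSubstrips a b W := fun a' b' hs => by
    obtain ⟨C, hC⟩ := hbdd a' b' hs
    refine ⟨C, fun z hz => ?_⟩
    refine le_of_tendsto (((hWan z (hs.subset hz)).continuousAt.norm.tendsto).mono_left
      (nhdsWithin_le_nhds (s := {z}ᶜ))) ?_
    filter_upwards [hw.eventually_not_isPoleAt (hs.subset hz),
      mem_nhdsWithin_of_mem_nhds ((isOpen_horizontalStrip _ _).mem_nhds hz)] with y hy hy'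
    rw [hWf y hy.1 hy.2]
    exact hC y hy' hy.2
  refine ⟨W, isBohrAP_of_root (n := k) (A := fun j => if j < k then B j else fun _ => 1)
    (fun j => ?_) hWd hWb (fun z hz => ?_) ⟨k, le_rfl, z₁, hz₁, by simp⟩, hWf⟩
  · by_cases hj : j < k
    · simpa [hj] using hB j
    · simpa [hj] using IsBohrAP.const 1
  · have hsum : ∀ y, ∑ j ∈ Finset.range (k + 1),
        (if j < k then B j else fun _ => 1) y * W y ^ j
        = W y ^ k + ∑ j ∈ Finset.range k, B j y * W y ^ j := fun y => by
      rw [Finset.sum_range_succ, add_comm]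
      congr 1
      · simp
      · exact Finset.sum_congr rfl fun j hj => by rw [if_pos (Finset.mem_range.1 hj)]
    rw [hsum]
    have hWc := (hWan z hz).continuousAt
    have hlim : Tendsto (fun y => W y ^ k + ∑ j ∈ Finset.range k, B j y * W y ^ j) (𝓝[≠] z)
        (𝓝 (W z ^ k + ∑ j ∈ Finset.range k, B j z * W z ^ j)) := by
      refine Tendsto.mono_left ?_ nhdsWithin_le_nhds
      refine (hWc.pow k).tendsto.add (tendsto_finsetSum _ fun j _ => ?_)
      exact Tendsto.mul (((hB j).differentiableOn.continuousOn.continuousAt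
        ((isOpen_horizontalStrip a b).mem_nhds hz)).tendsto) (hWc.pow j).tendsto
    refine tendsto_nhds_unique_of_eventuallyEq hlim tendsto_const_nhds ?_
    filter_upwards [hw.eventually_not_isPoleAt hz] with y hy
    rw [hWf y hy.1 hy.2]
    exact hmonic y hy.1 hy.2

/-! ### Conclusion of the proof -/

theorem not_isPoleAt_and_isAnalyticAP {a b : EReal} {k : ℕ} {A : ℕ → ℂ → ℂ} {w : ℂ → ℂ}
    (hA : ∀ j, IsBohrAP a b (A j)) (hk : ∃ z ∈ horizontalStrip a b, A k z ≠ 0)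
    (hw : IsMeromorphicFunctionOn w (horizontalStrip a b))
    (heq : ∀ z ∈ horizontalStrip a b, ¬ IsPoleAt w z →
      ∑ j ∈ Finset.range (k + 1), A j z * w z ^ j = 0)
    (hpoles : ∀ a' b' : ℝ, IsSubstrip a' b' a b →
      (fun t : ℝ => (poleCount w a' b' t : ℝ)) =o[atTop] (fun t : ℝ => t)) :
    (∀ z ∈ horizontalStrip a b, ¬ IsPoleAt w z) ∧ IsAnalyticAP a b w := by
  obtain ⟨W, hW, hmul⟩ := exists_isBohrAP_mul_eq hA hk hw heq
  have hno := not_isPoleAt_of_mul_eq (hA k) hk hW hw hmul hpoles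
  have hd : DifferentiableOn ℂ w (horizontalStrip a b) := fun z hz =>
    (hw.2 z hz (hno z hz)).differentiableAt.differentiableWithinAt
  have hb := bddOnSubstrips_of_mul_eq (hA k) hk hW.bdd hd fun z hz => hmul z hz (hno z hz)
  exact ⟨hno, (isBohrAP_of_root hA hd hb (fun z hz => heq z hz (hno z hz))
    ⟨k, le_rfl, hk⟩).isAnalyticAP⟩

theorem theorem2 (a b : EReal) (m : ℕ) (c : Fin (m + 1) → ℂ → ℂ) (w : ℂ → ℂ)
    (hc : ∀ j, IsAnalyticAP a b (c j))
    (hc0 : ∃ j, ∃ z ∈ horizontalStrip a b, c j z ≠ 0)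
    (hw : IsMeromorphicFunctionOn w (horizontalStrip a b))
    (heq : ∀ z ∈ horizontalStrip a b, ¬ IsPoleAt w z → ∑ j, c j z * w z ^ (j : ℕ) = 0)
    (hpoles : ∀ a' b' : ℝ, IsSubstrip a' b' a b →
      (fun t : ℝ => (poleCount w a' b' t : ℝ)) =o[atTop] (fun t : ℝ => t)) :
    (∀ z ∈ horizontalStrip a b, ¬ IsPoleAt w z) ∧ IsAnalyticAP a b w := by
  classical
  let A : ℕ → ℂ → ℂ := fun j => if h : j < m + 1 then c ⟨j, h⟩ else fun _ => 0
  have hA : ∀ j, IsBohrAP a b (A j) := fun j => by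
    by_cases h : j < m + 1
    · simp only [A, dif_pos h]
      exact (hc ⟨j, h⟩).isBohrAP
    · simp only [A, dif_neg h]
      exact IsBohrAP.const 0
  have hAc : ∀ j : Fin (m + 1), A j = c j := fun j => dif_pos j.2
  -- The given leading coefficient may vanish identically, so the degree is lowered to the last
  -- coefficient that does not.
  let k := Nat.findGreatest (fun j => ∃ z ∈ horizontalStrip a b, A j z ≠ 0) m
  obtain ⟨j₀, hj₀⟩ := hc0
  have hk : ∃ z ∈ horizontalStrip a b, A k z ≠ 0 :=
    Nat.findGreatest_spec (P := fun j => ∃ z ∈ horizontalStrip a b, A j z ≠ 0)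
      (Nat.lt_succ_iff.1 j₀.2) (by rwa [hAc])
  have hkm : k ≤ m := Nat.findGreatest_le m
  refine not_isPoleAt_and_isAnalyticAP hA hk hw (fun z hz hp => ?_) hpoles
  have h1 := heq z hz hp
  simp only [← hAc] at h1
  rw [Fin.sum_univ_eq_sum_range (fun j => A j z * w z ^ j)] at h1
  rw [← h1]
  refine Finset.sum_subset (Finset.range_mono (by omega)) fun j hj hjk => ?_
  rw [Finset.mem_range] at hj hjk
  have h2 := Nat.findGreatest_is_greatest (P := fun j => ∃ z ∈ horizontalStrip a b, A j z ≠ 0)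
    (show k < j by omega) (by omega)
  push Not at h2
  rw [h2 z hz, zero_mul]
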